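/- For a real number $\xi$ and an integer $n\ge 1$, let $\lambda_n(\xi)$ (respectively $\widehat\lambda_n(\xi)$) be the supremum in $[-\infty,\infty]$ of the real numbers $\lambda$ for which the system \[ 1\le x\le X,\qquad \max_{1\le j\le n}|\xi^j x-y_j|\le X^{-\lambda} \] has a solution $(x,y_1,\dots,y_n)\in\mathbb Z^{n+1}$ for arbitrarily large real $X$ (respectively for all sufficiently large real $X$). Let $w_n(\xi)$ (respectively $\widehat w_n(\xi)$) be the supremum in $[-\infty,\infty]$ of the real numbers $w$ for which the system \[ 1\le \max_{1\le j\le n}|a_j|\le X,\qquad |a_0+a_1\xi+\cdots+a_n\xi^n|\le X^{-w} \] has a solution $(a_0,\dots,a_n)\in\mathbb Z^{n+1}$ for arbitrarily large real $X$ (respectively for all sufficiently large real $X$). Let $\xi$ be a transcendental real number with $\widehat\lambda_4(\xi)>1/3$. Then $\widehat\lambda_4(\xi)<1/2$ and $\lambda_4(\xi)<1$ (so that all denominators below are positive), \[ \frac{3\widehat\lambda_4(\xi)+1}{3\widehat\lambda_4(\xi)-1}\ \ge\ w_3(\xi)\ \ge\ \max\left\{\frac{3\widehat\lambda_4(\xi)}{1-2\widehat\lambda_4(\xi)},\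 \frac{3\lambda_4(\xi)+1}{1-\lambda_4(\xi)}\right\}, \qquad \widehat w_3(\xi)\ \ge\ \frac{3\widehat\lambda_4(\xi)+1}{1-\widehat\lambda_4(\xi)}, \] and \[ w_2(\xi)\ \le\ \frac{1}{\widehat\lambda_4(\xi)}\ <\ 3 . \] -/

import Mathlib

/-- The system `1 ≤ x ≤ X`, `max_{1 ≤ j ≤ n} |ξ^j x - y_j| ≤ X^(-l)` has an integer solution
`(x, y_1, …, y_n)`. The entry `y j` with `j : Fin n` is `y_{j+1}`. -/
def SimultaneousSolvable (n : ℕ) (ξ l X : ℝ) : Prop :=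
  ∃ (x : ℤ) (y : Fin n → ℤ), 1 ≤ x ∧ (x : ℝ) ≤ X ∧
    ∀ j : Fin n, |ξ ^ ((j : ℕ) + 1) * (x : ℝ) - (y j : ℝ)| ≤ X ^ (-l)

/-- The system `1 ≤ max_{1 ≤ j ≤ n} |a_j| ≤ X`, `|a_0 + a_1 ξ + ⋯ + a_n ξ^n| ≤ X^(-w)` has an
integer solution `(a_0, …, a_n)`. -/
def LinearFormSolvable (n : ℕ) (ξ w X : ℝ) : Prop :=
  ∃ a : Fin (n + 1) → ℤ, (∃ j : Fin n, 1 ≤ |a j.succ|) ∧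
    (∀ j : Fin n, |(a j.succ : ℝ)| ≤ X) ∧
    |∑ i : Fin (n + 1), (a i : ℝ) * ξ ^ (i : ℕ)| ≤ X ^ (-w)

/-- The ordinary exponent `λ_n(ξ)`: solvability for arbitrarily large `X`. -/
noncomputable def ordinaryLambda (n : ℕ) (ξ : ℝ) : EReal :=
  sSup ((fun l : ℝ => (l : EReal)) '' {l : ℝ | ∃ᶠ X in Filter.atTop, SimultaneousSolvable n ξ l X})

/-- The uniform exponent `λ̂_n(ξ)`: solvability for all sufficiently large `X`. -/
noncomputable def uniformLambda (n : ℕ) (ξ : ℝ) : EReal :=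
  sSup ((fun l : ℝ => (l : EReal)) '' {l : ℝ | ∀ᶠ X in Filter.atTop, SimultaneousSolvable n ξ l X})

/-- The ordinary exponent `w_n(ξ)`: solvability for arbitrarily large `X`. -/
noncomputable def ordinaryW (n : ℕ) (ξ : ℝ) : EReal :=
  sSup ((fun w : ℝ => (w : EReal)) '' {w : ℝ | ∃ᶠ X in Filter.atTop, LinearFormSolvable n ξ w X})

/-- The uniform exponent `ŵ_n(ξ)`: solvability for all sufficiently large `X`. -/
noncomputable def uniformW (n : ℕ) (ξ : ℝ) : EReal :=
  sSup ((fun w : ℝ => (w : EReal)) '' {w : ℝ | ∀ᶠ X in Filter.atTop, LinearFormSolvable n ξ w X})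

/-! Let `M(x)` be the functional on integer polynomials of degree at most `4` sending `X ^ i` to
`x i`. If `q` is the denominator of a good approximation to `(ξ, …, ξ ^ 4)` with numerators
`x = (q, y₁, …, y₄)`, then `M(x)` sends `R` to `q R(ξ)` up to a small error; being an integer, the
value vanishes as soon as `R` has small height and takes a small value at `ξ`.

The hypothesis `λ̂_4 > 1/3` bounds the values at `ξ` of polynomials of degree at most `2` from below
by a power of the height larger than `-3`, first for irreducible polynomials and then for all of
them since the Mahler measure is multiplicative; this contains the bound for `w_2`. Take consecutive
minimal polynomials `P`, `Q` of degree at most `3`. They are too small at `ξ` to be products of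
polynomials of degree at most `2`, hence coprime, and the good approximations are orthogonal to
`P`, `X P`, `Q`, `X Q`:

* A lattice vector orthogonal to `(x 0, …, x 3)` and `(x 1, …, x 4)` would be a polynomial
  contradicting the minimality of `Q` unless the height of `Q` is at most `|P(ξ)| ^ (2 λ̂ - 1)` up
  to a constant. This gives the lower bound for `ŵ_3`, and together with the resultant of `P` and
  `Q` also `λ̂ ≤ 2/5` and the upper bound for `w_3`.
* A short vector orthogonal to `(x 0, …, x 3)` and `(x 1, …, x 4)` for one very good approximation
  `x` gives the lower bound for `w_3` in terms of `λ_4`; compared with the upper bound for `w_3`, it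
  forces `λ_4 < 1`.
* If `x'` is the next better approximation, one of `P`, `X P`, `Q`, `X Q` is no longer orthogonal to
  it. The cross product of `(x 0, …, x 3)`, `(x 1, …, x 4)` and one of `(x' 0, …, x' 3)`,
  `(x' 1, …, x' 4)` is then nonzero, and gives the lower bound for `w_3` in terms of `λ̂_4`.
-/

open Polynomial Filter

section Height

theorem abs_coeff_le_supNorm (P : ℤ[X]) (i : ℕ) : |(P.coeff i : ℝ)| ≤ P.supNorm :=
  P.le_supNorm i

theorem supNorm_le_of_abs_coeff_le {P : ℤ[X]} {B : ℝ} (h : ∀ i, |(P.coeff i : ℝ)| ≤ B) :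
    P.supNorm ≤ B := by
  obtain ⟨i, hi⟩ := P.exists_eq_supNorm
  exact hi ▸ h i

theorem one_le_supNorm {P : ℤ[X]} (hP : P ≠ 0) : 1 ≤ P.supNorm := by
  have h : (1 : ℝ) ≤ |(P.leadingCoeff : ℝ)| := by
    exact_mod_cast Int.one_le_abs (leadingCoeff_ne_zero.mpr hP)
  exact h.trans (abs_coeff_le_supNorm P P.natDegree)

theorem supNorm_pos {P : ℤ[X]} (hP : P ≠ 0) : 0 < P.supNorm :=
  one_pos.trans_le (one_le_supNorm hP)

theorem finite_setOf_supNorm_le (n : ℕ) (B : ℝ) :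
    {P : ℤ[X] | P.natDegree ≤ n ∧ P.supNorm ≤ B}.Finite := by
  let coeffs : ℤ[X] → (Fin (n + 1) → ℤ) := fun P i => P.coeff i
  refine Set.Finite.of_finite_image (f := coeffs)
    ((Set.finite_Icc (fun _ => -⌈B⌉) (fun _ => ⌈B⌉)).subset ?_) ?_
  · rintro _ ⟨P, ⟨-, hP⟩, rfl⟩
    have hbound (i : ℕ) : |P.coeff i| ≤ ⌈B⌉ := by
      exact_mod_cast ((abs_coeff_le_supNorm P i).trans hP).trans (Int.le_ceil B)
    exact ⟨fun i => (abs_le.mp (hbound i)).1, fun i => (abs_le.mp (hbound i)).2⟩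
  · rintro P ⟨hP, -⟩ Q ⟨hQ, -⟩ h
    ext i
    by_cases hi : i < n + 1
    · exact congrFun h ⟨i, hi⟩
    · rw [coeff_eq_zero_of_natDegree_lt (by omega), coeff_eq_zero_of_natDegree_lt (by omega)]

theorem aeval_eq_sum_fin (ξ : ℝ) {n : ℕ} {P : ℤ[X]} (hP : P.natDegree < n) :
    aeval ξ P = ∑ i : Fin n, (P.coeff i : ℝ) * ξ ^ (i : ℕ) := by
  rw [aeval_eq_sum_range' hP, Finset.sum_range]
  simp only [zsmul_eq_mul]

theorem aeval_ofFn (ξ : ℝ) {n : ℕ} (r : Fin n → ℤ) :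
    aeval ξ (ofFn n r) = ∑ i, (r i : ℝ) * ξ ^ (i : ℕ) := by
  rcases Nat.eq_zero_or_pos n with rfl | hn
  · simp
  · simp only [aeval_eq_sum_fin ξ (ofFn_natDegree_lt hn r), ofFn_coeff_eq_val_of_lt r (Fin.is_lt _)]

theorem supNorm_ofFn_le {n : ℕ} {r : Fin n → ℤ} {B : ℝ} (hB : 0 ≤ B)
    (h : ∀ i, |(r i : ℝ)| ≤ B) : (ofFn n r).supNorm ≤ B := by
  refine supNorm_le_of_abs_coeff_le fun i => ?_
  rcases lt_or_ge i n with hi | hi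
  · rw [ofFn_coeff_eq_val_of_lt r hi]
    exact h _
  · simpa [ofFn_coeff_eq_zero_of_ge r hi]

theorem ofFn_ne_zero {n : ℕ} {r : Fin n → ℤ} (h : r ≠ 0) : ofFn n r ≠ 0 :=
  (map_ne_zero_iff _ (injective_ofFn n)).mpr h

theorem aeval_ne_zero {ξ : ℝ} (hξ : Transcendental ℚ ξ) {P : ℤ[X]} (hP : P ≠ 0) :
    aeval ξ P ≠ 0 := by
  have h : Transcendental ℤ ξ := fun h => hξ ((IsFractionRing.isAlgebraic_iff ℤ ℚ ℝ).mp h)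
  exact fun h0 => hP (transcendental_iff.mp h P h0)

theorem abs_aeval_pos {ξ : ℝ} (hξ : Transcendental ℚ ξ) {P : ℤ[X]} (hP : P ≠ 0) :
    0 < |aeval ξ P| :=
  abs_pos.mpr (aeval_ne_zero hξ hP)

theorem exists_forall_le_abs_aeval {ξ : ℝ} (hξ : Transcendental ℚ ξ) (n : ℕ) (B : ℝ) :
    ∃ c : ℝ, 0 < c ∧ ∀ P : ℤ[X], P ≠ 0 → P.natDegree ≤ n → P.supNorm ≤ B → c ≤ |aeval ξ P| := by
  let s := {P : ℤ[X] | P.natDegree ≤ n ∧ P.supNorm ≤ B} \ {0}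
  have hs : s.Finite := (finite_setOf_supNorm_le n B).subset Set.sdiff_subset
  by_cases hne : s.Nonempty
  · obtain ⟨P, hP, hmin⟩ := s.exists_min_image (fun P => |aeval ξ P|) hs hne
    exact ⟨|aeval ξ P|, abs_aeval_pos hξ hP.2, fun Q hQ hd hB => hmin Q ⟨⟨hd, hB⟩, hQ⟩⟩
  · exact ⟨1, one_pos, fun Q hQ hd hB => (hne ⟨Q, ⟨hd, hB⟩, hQ⟩).elim⟩

end Height

section LinearForms

theorem natDegree_ne_zero_of_abs_aeval_lt_one {ξ : ℝ} {P : ℤ[X]} (hP : P ≠ 0)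
    (h : |aeval ξ P| < 1) : P.natDegree ≠ 0 := by
  intro hd
  obtain ⟨a, rfl⟩ : ∃ a, P = C a := ⟨_, eq_C_of_natDegree_eq_zero hd⟩
  rw [aeval_C, algebraMap_int_eq, eq_intCast] at h
  have ha : a = 0 := Int.abs_lt_one_iff.mp (by exact_mod_cast h)
  exact hP (by rw [ha, C_0])

theorem linearFormSolvable_of_polynomial {n : ℕ} {ξ w X : ℝ} {P : ℤ[X]} (hP : P.natDegree ≠ 0)
    (hd : P.natDegree ≤ n) (hH : P.supNorm ≤ X) (hv : |aeval ξ P| ≤ X ^ (-w)) :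
    LinearFormSolvable n ξ w X := by
  refine ⟨fun i => P.coeff i, ⟨⟨P.natDegree - 1, by omega⟩, ?_⟩,
    fun j => (abs_coeff_le_supNorm P _).trans hH, ?_⟩
  · have hlead : P.coeff P.natDegree ≠ 0 :=
      leadingCoeff_ne_zero.mpr fun h => hP (by simp [h])
    have hidx : P.natDegree - 1 + 1 = P.natDegree := by omega
    simpa only [Fin.val_succ, hidx] using Int.one_le_abs hlead
  · rwa [← aeval_eq_sum_fin ξ (by omega)]

theorem abs_zero_coeff_le_of_abs_le {n : ℕ} {ξ X e : ℝ} {a : Fin (n + 1) → ℤ}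
    (ha : ∀ j : Fin n, |(a j.succ : ℝ)| ≤ X)
    (hv : |∑ i : Fin (n + 1), (a i : ℝ) * ξ ^ (i : ℕ)| ≤ e) :
    |(a 0 : ℝ)| ≤ e + X * ∑ j : Fin n, |ξ| ^ ((j : ℕ) + 1) := by
  set tail := ∑ j : Fin n, (a j.succ : ℝ) * ξ ^ ((j : ℕ) + 1) with htail
  have hsplit : (a 0 : ℝ) = ∑ i : Fin (n + 1), (a i : ℝ) * ξ ^ (i : ℕ) - tail := by
    rw [Fin.sum_univ_succ]
    simp only [Fin.val_zero, pow_zero, mul_one, Fin.val_succ, htail, add_sub_cancel_right]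
  have htail_le : |tail| ≤ X * ∑ j : Fin n, |ξ| ^ ((j : ℕ) + 1) := by
    rw [Finset.mul_sum]
    refine (Finset.abs_sum_le_sum_abs _ _).trans (Finset.sum_le_sum fun j _ => ?_)
    rw [abs_mul, abs_pow]
    gcongr
    exact ha j
  rw [hsplit]
  exact (abs_sub _ _).trans (add_le_add hv htail_le)

theorem exists_polynomial_of_linearFormSolvable (n : ℕ) (ξ : ℝ) :
    ∃ A : ℝ, 1 ≤ A ∧ ∀ w X : ℝ, 0 ≤ w → 1 ≤ X → LinearFormSolvable n ξ w X →
      ∃ P : ℤ[X], P ≠ 0 ∧ P.natDegree ≤ n ∧ P.supNorm ≤ A * X ∧ |aeval ξ P| ≤ X ^ (-w) := by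
  have hS : 0 ≤ ∑ j : Fin n, |ξ| ^ ((j : ℕ) + 1) := by positivity
  refine ⟨1 + ∑ j : Fin n, |ξ| ^ ((j : ℕ) + 1), by linarith, ?_⟩
  rintro w X hw hX ⟨a, ⟨j, hj⟩, haX, hv⟩
  have ha : a ≠ 0 := fun h => by simp [h] at hj
  refine ⟨ofFn (n + 1) a, ofFn_ne_zero ha, Nat.le_of_lt_succ (ofFn_natDegree_lt n.succ_pos a),
    supNorm_ofFn_le (by positivity) fun i => ?_, by rwa [aeval_ofFn]⟩
  have hsmall : X ^ (-w) ≤ X :=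
    (Real.rpow_le_one_of_one_le_of_nonpos hX (neg_nonpos.mpr hw)).trans hX
  induction i using Fin.cases with
  | zero => linarith [abs_zero_coeff_le_of_abs_le haX hv]
  | succ k => nlinarith [haX k]

end LinearForms

section Dirichlet

theorem exists_ne_map_eq_mul_abs_sub_le {α β : Type*} [Finite β] (g : α → β)
    {w : α → ℝ} {M : ℝ} (hw : ∀ a, w a ∈ Set.Ico 0 M) {K : ℕ} (hK : K ≠ 0)
    (hcard : Nat.card β * K < Nat.card α) :
    ∃ a b, a ≠ b ∧ g a = g b ∧ K * |w a - w b| ≤ M := by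
  have hM (a : α) : 0 < M := (hw a).1.trans_lt (hw a).2
  have hKpos : (0 : ℝ) < K := by positivity
  have hlt (a : α) : ⌊K * w a / M⌋₊ < K := by
    rw [Nat.floor_lt (div_nonneg (mul_nonneg hKpos.le (hw a).1) (hM a).le), div_lt_iff₀ (hM a)]
    exact mul_lt_mul_of_pos_left (hw a).2 hKpos
  have hnot : ¬ Function.Injective fun a => (g a, (⟨_, hlt a⟩ : Fin K)) := fun hinj =>
    hcard.not_ge (by simpa using Nat.card_le_card_of_injective _ hinj)
  obtain ⟨a, b, heq, hab⟩ := Function.not_injective_iff.mp hnot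
  obtain ⟨hg, hfloor⟩ := Prod.mk.inj heq
  refine ⟨a, b, hab, hg, ?_⟩
  have hnonneg (c : α) : 0 ≤ K * w c / M := div_nonneg (mul_nonneg hKpos.le (hw c).1) (hM a).le
  have hdist : |K * w a / M - K * w b / M| < 1 := by
    refine Int.abs_sub_lt_one_of_floor_eq_floor ?_
    rw [← Int.natCast_floor_eq_floor (hnonneg a), ← Int.natCast_floor_eq_floor (hnonneg b)]
    exact congrArg Nat.cast (congrArg Fin.val hfloor)
  rw [← sub_div, ← mul_sub, abs_div, abs_mul, abs_of_pos hKpos, abs_of_pos (hM a),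
    div_lt_one (hM a)] at hdist
  exact hdist.le

theorem abs_natCast_sub_natCast_le {s : ℕ} (a b : Fin (s + 1)) :
    |((a : ℕ) : ℝ) - ((b : ℕ) : ℝ)| ≤ s := by
  have ha : ((a : ℕ) : ℝ) ≤ s := by exact_mod_cast a.is_le
  have hb : ((b : ℕ) : ℝ) ≤ s := by exact_mod_cast b.is_le
  exact abs_sub_le_of_nonneg_of_le (Nat.cast_nonneg _) ha (Nat.cast_nonneg _) hb

theorem linearFormSolvable_dirichlet {n : ℕ} (hn : n ≠ 0) (ξ : ℝ) {N : ℕ} (hN : N ≠ 0) :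
    LinearFormSolvable n ξ n N := by
  let form (a : Fin n → Fin (N + 1)) : ℝ := ∑ j, ((a j : ℕ) : ℝ) * ξ ^ ((j : ℕ) + 1)
  obtain ⟨a, b, hab, -, hclose⟩ := exists_ne_map_eq_mul_abs_sub_le (fun _ => ())
    (w := fun a => Int.fract (form a)) (M := 1)
    (fun a => ⟨Int.fract_nonneg _, Int.fract_lt_one _⟩) (pow_ne_zero n hN)
    (by simpa using Nat.pow_lt_pow_left N.lt_succ_self hn)
  refine ⟨Fin.cons (⌊form b⌋ - ⌊form a⌋) fun j => ((a j : ℕ) : ℤ) - (b j : ℕ), ?_, fun j => ?_, ?_⟩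
  · obtain ⟨j, hj⟩ := Function.ne_iff.mp hab
    refine ⟨j, Int.one_le_abs ?_⟩
    rw [Fin.cons_succ, sub_ne_zero]
    exact_mod_cast Fin.val_ne_of_ne hj
  · rw [Fin.cons_succ]
    exact_mod_cast abs_natCast_sub_natCast_le (a j) (b j)
  · have hvalue : ∑ i : Fin (n + 1),
        ((Fin.cons (⌊form b⌋ - ⌊form a⌋) (fun j => ((a j : ℕ) : ℤ) - (b j : ℕ)) :
          Fin (n + 1) → ℤ) i : ℝ) * ξ ^ (i : ℕ) = Int.fract (form a) - Int.fract (form b) := by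
      simp only [Fin.sum_univ_succ, Fin.cons_zero, Fin.cons_succ, Fin.val_zero, Fin.val_succ,
        Int.cast_sub, Int.cast_natCast, sub_mul, Finset.sum_sub_distrib, form, Int.fract]
      ring
    rw [hvalue, Real.rpow_neg (Nat.cast_nonneg N), Real.rpow_natCast, ← one_div,
      le_div_iff₀ (by positivity), mul_comm]
    exact_mod_cast hclose

theorem exists_polynomial_dirichlet {n : ℕ} (hn : n ≠ 0) (ξ : ℝ) :
    ∃ C : ℝ, 1 ≤ C ∧ ∀ X : ℝ, 1 ≤ X → ∃ P : ℤ[X], P ≠ 0 ∧ P.natDegree ≤ n ∧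
      P.supNorm ≤ C * X ∧ |aeval ξ P| * X ^ n ≤ 1 := by
  obtain ⟨A, hA, hpoly⟩ := exists_polynomial_of_linearFormSolvable n ξ
  refine ⟨2 * A, by linarith, fun X hX => ?_⟩
  have hXN : X ≤ ⌈X⌉₊ := Nat.le_ceil X
  have hNX : (⌈X⌉₊ : ℝ) ≤ 2 * X := by linarith [Nat.ceil_lt_add_one (zero_le_one.trans hX)]
  have hN : (0 : ℝ) < ⌈X⌉₊ := by linarith
  obtain ⟨P, hP, hd, hH, hv⟩ := hpoly n ⌈X⌉₊ (Nat.cast_nonneg n) (hX.trans hXN)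
    (linearFormSolvable_dirichlet hn ξ (Nat.cast_pos.mp hN).ne')
  refine ⟨P, hP, hd, hH.trans (by nlinarith), ?_⟩
  rw [Real.rpow_neg hN.le, Real.rpow_natCast, ← one_div, le_div_iff₀ (by positivity)] at hv
  exact (by gcongr : _ ≤ |aeval ξ P| * (⌈X⌉₊ : ℝ) ^ n).trans hv

end Dirichlet

section MinimalPairs

/-- Consecutive minimal polynomials of degree at most `d`: `P` minimizes `|P(ξ)|` among the nonzero
integer polynomials of degree at most `d` and height at most `N`, and `Q` has minimal height among
those taking a smaller absolute value at `ξ`. -/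
structure MinimalPair (d : ℕ) (ξ N : ℝ) (P Q : ℤ[X]) : Prop where
  left_ne_zero : P ≠ 0
  right_ne_zero : Q ≠ 0
  left_natDegree_le : P.natDegree ≤ d
  right_natDegree_le : Q.natDegree ≤ d
  left_supNorm_le : P.supNorm ≤ N
  lt_right_supNorm : N < Q.supNorm
  abs_aeval_lt : |aeval ξ Q| < |aeval ξ P|
  abs_aeval_le : ∀ R : ℤ[X], R ≠ 0 → R.natDegree ≤ d → R.supNorm < Q.supNorm →
    |aeval ξ P| ≤ |aeval ξ R|

theorem exists_abs_aeval_lt {d : ℕ} (hd : d ≠ 0) (ξ : ℝ) {ε : ℝ} (hε : 0 < ε) :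
    ∃ P : ℤ[X], P ≠ 0 ∧ P.natDegree ≤ d ∧ |aeval ξ P| < ε := by
  obtain ⟨C, -, hC⟩ := exists_polynomial_dirichlet hd ξ
  obtain ⟨P, hP, hPd, -, hv⟩ := hC (ε⁻¹ + 1) (by simp [hε.le])
  refine ⟨P, hP, hPd, ?_⟩
  have hX : ε⁻¹ < (ε⁻¹ + 1) ^ d :=
    (lt_add_one _).trans_le (le_self_pow₀ (by simp [hε.le]) hd)
  by_contra! hle
  have : ε * ε⁻¹ < |aeval ξ P| * (ε⁻¹ + 1) ^ d :=
    mul_lt_mul' hle hX (inv_pos.mpr hε).le (hε.trans_le hle)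
  rw [mul_inv_cancel₀ hε.ne'] at this
  exact this.not_ge hv

theorem exists_minimalPair {d : ℕ} (hd : d ≠ 0) {ξ : ℝ} (hξ : Transcendental ℚ ξ) {N : ℝ}
    (hN : 1 ≤ N) : ∃ P Q : ℤ[X], MinimalPair d ξ N P Q := by
  obtain ⟨P, ⟨⟨hPd, hPN⟩, hP : P ≠ 0⟩, hPmin⟩ := Set.exists_min_image
    ({P : ℤ[X] | P.natDegree ≤ d ∧ P.supNorm ≤ N} \ {0}) (fun P => |aeval ξ P|)
    ((finite_setOf_supNorm_le d N).subset Set.sdiff_subset)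
    ⟨C 1, ⟨natDegree_C 1 |>.trans_le d.zero_le, by rwa [supNorm_C, norm_one]⟩, by simp⟩
  obtain ⟨Q₀, hQ₀, hQ₀d, hQ₀v⟩ := exists_abs_aeval_lt hd ξ (abs_aeval_pos hξ hP)
  obtain ⟨Q, ⟨⟨hQd, hQle⟩, hQ, hQv⟩, hQmin⟩ := Set.exists_min_image
    {Q : ℤ[X] | (Q.natDegree ≤ d ∧ Q.supNorm ≤ Q₀.supNorm) ∧ Q ≠ 0 ∧ |aeval ξ Q| < |aeval ξ P|}
    (fun Q => Q.supNorm) ((finite_setOf_supNorm_le d Q₀.supNorm).subset fun Q h => h.1)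
    ⟨Q₀, ⟨hQ₀d, le_rfl⟩, hQ₀, hQ₀v⟩
  refine ⟨P, Q, hP, hQ, hPd, hQd, hPN, ?_, hQv, fun R hR hRd hRQ => ?_⟩
  · by_contra! h
    exact (hPmin Q ⟨⟨hQd, h⟩, hQ⟩).not_gt hQv
  · by_contra! h
    exact (hQmin R ⟨⟨hRd, hRQ.le.trans hQle⟩, hR, h⟩).not_gt hRQ

theorem exists_minimalPair_mul_pow_le {d : ℕ} (hd : d ≠ 0) (ξ : ℝ) :
    ∃ C : ℝ, 0 < C ∧ ∀ (N : ℝ) (P Q : ℤ[X]), MinimalPair d ξ N P Q →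
      |aeval ξ P| * Q.supNorm ^ d ≤ C := by
  obtain ⟨C, hC1, hC⟩ := exists_polynomial_dirichlet hd ξ
  have hC0 : 0 < 2 * C := by linarith
  refine ⟨(2 * C) ^ d, by positivity, fun N P Q h => ?_⟩
  have hQ := supNorm_pos h.right_ne_zero
  rcases lt_or_ge Q.supNorm (2 * C) with hsmall | hlarge
  · have hQ1 : 1 < Q.supNorm :=
      ((one_le_supNorm h.left_ne_zero).trans h.left_supNorm_le).trans_lt h.lt_right_supNorm
    have hP : |aeval ξ P| ≤ 1 := by
      simpa using h.abs_aeval_le 1 one_ne_zero (by simp) (by rwa [← C_1, supNorm_C, norm_one])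
    calc |aeval ξ P| * Q.supNorm ^ d ≤ 1 * (2 * C) ^ d := by gcongr
      _ = (2 * C) ^ d := one_mul _
  · obtain ⟨R, hR, hRd, hRH, hRv⟩ := hC (Q.supNorm / (2 * C)) ((one_le_div hC0).mpr hlarge)
    have hRQ : R.supNorm < Q.supNorm := by
      have : C * (Q.supNorm / (2 * C)) = Q.supNorm / 2 := by field_simp
      linarith
    have hPR := h.abs_aeval_le R hR hRd hRQ
    calc |aeval ξ P| * Q.supNorm ^ d
        = |aeval ξ P| * (Q.supNorm / (2 * C)) ^ d * (2 * C) ^ d := by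
          rw [mul_assoc, ← mul_pow, div_mul_cancel₀ _ hC0.ne']
      _ ≤ |aeval ξ R| * (Q.supNorm / (2 * C)) ^ d * (2 * C) ^ d := by gcongr
      _ ≤ 1 * (2 * C) ^ d := by gcongr
      _ = (2 * C) ^ d := one_mul _

end MinimalPairs

section Minors

variable {R ι : Type*} [CommRing R]

/-- The minor of the `2 × ι` matrix with rows `u`, `v` on the columns `i`, `j`. -/
def minor₂ (u v : ι → R) (i j : ι) : R := u i * v j - u j * v i

/-- The minor of the `3 × ι` matrix with rows `z`, `u`, `v` on the columns `i`, `j`, `k`, expanded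
along the row `z`. -/
def minor₃ (z u v : ι → R) (i j k : ι) : R :=
  z i * minor₂ u v j k - z j * minor₂ u v i k + z k * minor₂ u v i j

theorem minor₂_intCast (u v : ι → ℤ) (i j : ι) :
    minor₂ (fun k => (u k : R)) (fun k => (v k : R)) i j = (minor₂ u v i j : ℤ) := by
  simp only [minor₂, Int.cast_sub, Int.cast_mul]

theorem sum_mul_minor₂_eq_zero [Fintype ι] {u v r : ι → R} (hu : r ⬝ᵥ u = 0) (hv : r ⬝ᵥ v = 0)
    (j : ι) : ∑ k, r k * minor₂ u v k j = 0 := by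
  calc ∑ k, r k * minor₂ u v k j = v j * (r ⬝ᵥ u) - u j * (r ⬝ᵥ v) := by
        simp only [dotProduct, minor₂, Finset.mul_sum, ← Finset.sum_sub_distrib]
        exact Finset.sum_congr rfl fun k _ => by ring
    _ = 0 := by rw [hu, hv, mul_zero, mul_zero, sub_zero]

theorem minor₂_mul_dotProduct [Fintype ι] {u v r : ι → R} (z : ι → R) (hu : r ⬝ᵥ u = 0)
    (hv : r ⬝ᵥ v = 0) (i j : ι) :
    minor₂ u v i j * (r ⬝ᵥ z) = ∑ k, r k * minor₃ z u v k i j := by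
  have hsum : ∑ k, r k * minor₃ z u v k i j = minor₂ u v i j * (r ⬝ᵥ z)
      - z i * ∑ k, r k * minor₂ u v k j + z j * ∑ k, r k * minor₂ u v k i := by
    simp only [dotProduct, minor₃, Finset.mul_sum, ← Finset.sum_sub_distrib,
      ← Finset.sum_add_distrib]
    exact Finset.sum_congr rfl fun k _ => by ring
  rw [hsum, sum_mul_minor₂_eq_zero hu hv, sum_mul_minor₂_eq_zero hu hv, mul_zero, mul_zero,
    sub_zero, add_zero]

end Minors

section OrthogonalLattice

theorem abs_sum_mul_le {ι : Type*} [Fintype ι] {f g : ι → ℝ} {a b : ℝ} (hf : ∀ k, |f k| ≤ a)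
    (hg : ∀ k, |g k| ≤ b) : |∑ k, f k * g k| ≤ Fintype.card ι * (a * b) := by
  refine (Finset.abs_sum_le_sum_abs _ _).trans ((Finset.sum_le_card_nsmul _ _ (a * b)
    fun k _ => ?_).trans_eq (by rw [nsmul_eq_mul, Finset.card_univ]))
  rw [abs_mul]
  exact mul_le_mul (hf k) (hg k) (abs_nonneg _) ((abs_nonneg _).trans (hf k))

variable {ι : Type*} [Fintype ι] {u v : ι → ℤ} {z : ι → ℝ} {i j : ι}

theorem intCast_dotProduct_eq_zero {r w : ι → ℤ} (h : r ⬝ᵥ w = 0) :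
    (fun k => (r k : ℝ)) ⬝ᵥ (fun k => (w k : ℝ)) = 0 := by
  simp only [dotProduct] at h ⊢
  exact_mod_cast h

theorem minor₂_mul_sum_eq_of_eq_off {r c : ι → ℤ} (hu : r ⬝ᵥ u = 0) (hv : r ⬝ᵥ v = 0)
    (hrc : ∀ k, k ≠ i → k ≠ j → r k = c k) :
    ((minor₂ u v i j : ℤ) : ℝ) * ∑ k, (r k : ℝ) * z k =
      ∑ k, (c k : ℝ) * minor₃ z (fun k => (u k : ℝ)) (fun k => (v k : ℝ)) k i j := by
  have hid := minor₂_mul_dotProduct z (intCast_dotProduct_eq_zero hu)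
    (intCast_dotProduct_eq_zero hv) i j
  rw [minor₂_intCast, dotProduct] at hid
  refine hid.trans (Finset.sum_congr rfl fun k _ => ?_)
  rcases eq_or_ne k i with rfl | hki
  · simp only [minor₃, minor₂]; ring
  rcases eq_or_ne k j with rfl | hkj
  · simp only [minor₃, minor₂]; ring
  · rw [hrc k hki hkj]

theorem abs_minor₂_mul_abs_dotProduct_le {E B : ℝ} (hE : ∀ k,
    |minor₃ z (fun k => (u k : ℝ)) (fun k => (v k : ℝ)) k i j| ≤ E) {r : ι → ℤ}
    (hu : r ⬝ᵥ u = 0) (hv : r ⬝ᵥ v = 0) (hr : ∀ k, |(r k : ℝ)| ≤ B) :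
    |((minor₂ u v i j : ℤ) : ℝ)| * |∑ k, (r k : ℝ) * z k| ≤ Fintype.card ι * (B * E) := by
  rw [← abs_mul, minor₂_mul_sum_eq_of_eq_off hu hv fun _ _ _ => rfl]
  exact abs_sum_mul_le hr hE

theorem card_quotient_range_toLin' {n : Type*} [Fintype n] [DecidableEq n] {A : Matrix n n ℤ}
    (hA : A.det ≠ 0) :
    Nat.card ((n → ℤ) ⧸ LinearMap.range (Matrix.toLin' A)) = A.det.natAbs := by
  have hinj : Function.Injective (Matrix.toLin' A) := by
    rw [← LinearMap.ker_eq_bot, LinearMap.ker_eq_bot']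
    intro m hm
    by_contra h
    exact hA (Matrix.exists_mulVec_eq_zero_iff.mp ⟨m, h, by rwa [Matrix.toLin'_apply] at hm⟩)
  rw [← Submodule.natAbs_det_equiv _ (LinearEquiv.ofInjective (Matrix.toLin' A) hinj),
    ← LinearMap.det_toLin' A]
  congr 2

theorem exists_orthogonal_eq_of_mem_range {c : ι → ℤ}
    (hc : ![c ⬝ᵥ u, c ⬝ᵥ v] ∈ LinearMap.range (Matrix.toLin' !![u i, u j; v i, v j])) :
    ∃ r : ι → ℤ, r ⬝ᵥ u = 0 ∧ r ⬝ᵥ v = 0 ∧ ∀ k, k ≠ i → k ≠ j → r k = c k := by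
  classical
  obtain ⟨m, hm⟩ := hc
  rw [Matrix.toLin'_apply] at hm
  have hu := congrFun hm 0
  have hv := congrFun hm 1
  simp only [Matrix.mulVec, dotProduct, Fin.sum_univ_two, Matrix.of_apply, Matrix.cons_val] at hu hv
  refine ⟨c - Pi.single i (m 0) - Pi.single j (m 1), ?_, ?_, fun k hki hkj => ?_⟩
  · rw [sub_dotProduct, sub_dotProduct, single_dotProduct, single_dotProduct, dotProduct]
    linear_combination -hu
  · rw [sub_dotProduct, sub_dotProduct, single_dotProduct, single_dotProduct, dotProduct]
    linear_combination -hv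
  · simp [hki, hkj]

theorem abs_apply_le_of_maximal_minor (hM : minor₂ u v i j ≠ 0)
    (hmax : ∀ k, |minor₂ u v k j| ≤ |minor₂ u v i j|) {r : ι → ℤ} (hu : r ⬝ᵥ u = 0)
    (hv : r ⬝ᵥ v = 0) {s : ℤ} (hr : ∀ k, k ≠ i → k ≠ j → |r k| ≤ s) (hs : 0 ≤ s) :
    |r i| ≤ Fintype.card ι * s := by
  classical
  have hsolve : minor₂ u v i j * r i = -∑ k ∈ Finset.univ.erase i, r k * minor₂ u v k j := by
    linear_combination (Finset.add_sum_erase Finset.univ (fun k => r k * minor₂ u v k j)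
      (Finset.mem_univ i)).trans (sum_mul_minor₂_eq_zero hu hv j)
  have hterm (k : ι) (hk : k ∈ Finset.univ.erase i) :
      |r k * minor₂ u v k j| ≤ s * |minor₂ u v i j| := by
    rw [abs_mul]
    rcases eq_or_ne k j with rfl | hkj
    · simpa [minor₂] using mul_nonneg hs (abs_nonneg _)
    · exact mul_le_mul (hr k (Finset.ne_of_mem_erase hk) hkj) (hmax k) (abs_nonneg _) hs
  refine le_of_mul_le_mul_left ?_ (abs_pos.mpr hM)
  calc |minor₂ u v i j| * |r i| = |∑ k ∈ Finset.univ.erase i, r k * minor₂ u v k j| := by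
        rw [← abs_mul, hsolve, abs_neg]
    _ ≤ (Finset.univ.erase i).card • (s * |minor₂ u v i j|) :=
        (Finset.abs_sum_le_sum_abs _ _).trans (Finset.sum_le_card_nsmul _ _ _ hterm)
    _ ≤ Fintype.card ι • (s * |minor₂ u v i j|) :=
        nsmul_le_nsmul_left (by positivity) (Finset.card_le_univ _)
    _ = |minor₂ u v i j| * (Fintype.card ι * s) := by rw [nsmul_eq_mul]; ring

theorem card_piFinset_ite_singleton_zero [DecidableEq ι] {d : ℕ}
    (hd : Fintype.card ι = d + 2) (hij : i ≠ j)
    (s : ℕ) : (Fintype.piFinset fun k => if k = i ∨ k = j then {0} else Finset.Icc 0 (s : ℤ)).card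
      = (s + 1) ^ d := by
  have hpair : (Finset.univ.filter fun k => k = i ∨ k = j) = {i, j} := by ext; simp
  have hcompl := Finset.card_filter_add_card_filter_not (s := Finset.univ) fun k => k = i ∨ k = j
  rw [hpair, Finset.card_pair hij, Finset.card_univ, hd] at hcompl
  have hval (k : ι) : (if k = i ∨ k = j then {0} else Finset.Icc 0 (s : ℤ)).card =
      if k = i ∨ k = j then 1 else s + 1 := by
    split_ifs <;> simp
  rw [Fintype.card_piFinset]
  simp only [hval, Finset.prod_ite, Finset.prod_const, one_pow, one_mul]
  congr 1
  omega

/-- Pigeonhole principle for the combinations with coefficients in `{0, …, s}` outside the columns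
`i`, `j`, modulo the lattice spanned by the columns `i`, `j` of the matrix with rows `u`, `v`. -/
theorem exists_mem_range_mul_abs_sum_le {d : ℕ} (hι : Fintype.card ι = d + 2) (hd : d ≠ 0)
    (hM : minor₂ u v i j ≠ 0) {s K : ℕ} (hs : s ≠ 0) (hK : K ≠ 0)
    (hsK : (minor₂ u v i j).natAbs * K ≤ s ^ d) {t : ι → ℝ} {E : ℝ} (hE : 0 < E)
    (ht : ∀ k, |t k| ≤ E) :
    ∃ c : ι → ℤ, c ≠ 0 ∧ c i = 0 ∧ c j = 0 ∧ (∀ k, |c k| ≤ s) ∧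
      ![c ⬝ᵥ u, c ⬝ᵥ v] ∈ LinearMap.range (Matrix.toLin' !![u i, u j; v i, v j]) ∧
      K * |∑ k, (c k : ℝ) * t k| ≤ 3 * (Fintype.card ι * (s * E)) := by
  classical
  have hij : i ≠ j := by rintro rfl; exact hM (sub_self _)
  set A : Matrix (Fin 2) (Fin 2) ℤ := !![u i, u j; v i, v j]
  have hA : A.det = minor₂ u v i j := Matrix.det_fin_two_of ..
  have hquot := card_quotient_range_toLin' (hA ▸ hM)
  have : Finite ((Fin 2 → ℤ) ⧸ LinearMap.range (Matrix.toLin' A)) :=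
    Nat.finite_of_card_ne_zero (by rw [hquot, hA]; exact Int.natAbs_ne_zero.mpr hM)
  let box := Fintype.piFinset fun k => if k = i ∨ k = j then {0} else Finset.Icc 0 (s : ℤ)
  have hbox (c : box) (k : ι) : 0 ≤ c.1 k ∧ c.1 k ≤ s ∧ (k = i ∨ k = j → c.1 k = 0) := by
    have := Fintype.mem_piFinset.mp c.2 k
    split_ifs at this <;> simp_all
  let w (c : box) : ℝ := ∑ k, (c.1 k : ℝ) * t k
  have hw (c : box) : |w c| ≤ Fintype.card ι * (s * E) := abs_sum_mul_le (fun k => by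
    rw [abs_of_nonneg (by exact_mod_cast (hbox c k).1)]; exact_mod_cast (hbox c k).2.1) ht
  have hpos : 0 < Fintype.card ι * (s * E) := by rw [hι]; positivity
  obtain ⟨a, b, hab, hmod, hclose⟩ := exists_ne_map_eq_mul_abs_sub_le
    (fun c : box => Submodule.Quotient.mk (p := LinearMap.range (Matrix.toLin' A))
      ![c.1 ⬝ᵥ u, c.1 ⬝ᵥ v])
    (w := fun c => w c + Fintype.card ι * (s * E)) (M := 3 * (Fintype.card ι * (s * E)))
    (fun c => ⟨by linarith [abs_le.mp (hw c)], by linarith [abs_le.mp (hw c)]⟩) hK (by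
      rw [hquot, hA, Nat.card_eq_fintype_card, Fintype.card_coe,
        card_piFinset_ite_singleton_zero hι hij]
      exact hsK.trans_lt (Nat.pow_lt_pow_left s.lt_succ_self hd))
  refine ⟨a.1 - b.1, sub_ne_zero.mpr (Subtype.coe_injective.ne hab), ?_, ?_, fun k => ?_, ?_, ?_⟩
  · simp [(hbox a i).2.2, (hbox b i).2.2]
  · simp [(hbox a j).2.2, (hbox b j).2.2]
  · exact abs_sub_le_of_nonneg_of_le (hbox a k).1 (hbox a k).2.1 (hbox b k).1 (hbox b k).2.1
  · simpa [sub_dotProduct] using (Submodule.Quotient.eq _).mp hmod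
  · simpa [w, sub_mul, Finset.sum_sub_distrib] using hclose

theorem abs_le_of_maximal_minor (hι : Fintype.card ι ≠ 0) (hM : minor₂ u v i j ≠ 0)
    (hmax : ∀ k l, |minor₂ u v k l| ≤ |minor₂ u v i j|) {r : ι → ℤ} (hu : r ⬝ᵥ u = 0)
    (hv : r ⬝ᵥ v = 0) {s : ℤ} (hs : 0 ≤ s) (hr : ∀ k, k ≠ i → k ≠ j → |r k| ≤ s) (k : ι) :
    |r k| ≤ Fintype.card ι * s := by
  classical
  have hswap (k l : ι) : |minor₂ u v k l| = |minor₂ u v l k| := abs_sub_comm ..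
  rcases eq_or_ne k i with rfl | hki
  · exact abs_apply_le_of_maximal_minor hM (hmax · _) hu hv hr hs
  rcases eq_or_ne k j with rfl | hkj
  · have hM' : minor₂ u v k i ≠ 0 := by rwa [← abs_pos, hswap, abs_pos]
    exact abs_apply_le_of_maximal_minor hM' (fun l => hswap i k ▸ hmax l i) hu hv
      (fun l hk hi => hr l hi hk) hs
  · exact (hr k hki hkj).trans (le_mul_of_one_le_left hs (by omega))

theorem exists_short_orthogonal {d : ℕ} (hι : Fintype.card ι = d + 2) (hd : d ≠ 0)
    (hM : minor₂ u v i j ≠ 0) (hmax : ∀ k l, |minor₂ u v k l| ≤ |minor₂ u v i j|) {E : ℝ}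
    (hE : 0 < E)
    (h₃ : ∀ k, |minor₃ z (fun k => (u k : ℝ)) (fun k => (v k : ℝ)) k i j| ≤ E) {s : ℕ}
    (hsM : |minor₂ u v i j| ≤ (s : ℤ) ^ d) :
    ∃ r : ι → ℤ, r ≠ 0 ∧ r ⬝ᵥ u = 0 ∧ r ⬝ᵥ v = 0 ∧ (∀ k, |r k| ≤ Fintype.card ι * s) ∧
      s ^ d * |∑ k, (r k : ℝ) * z k| ≤ 6 * (Fintype.card ι * (s * E)) := by
  classical
  set D := minor₂ u v i j with hD
  have hDpos : 0 < D.natAbs := Int.natAbs_pos.mpr hM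
  have hDs : D.natAbs ≤ s ^ d := by zify; exact hsM
  have hs : s ≠ 0 := by rintro rfl; rw [zero_pow hd] at hDs; omega
  have hK : 0 < s ^ d / D.natAbs := Nat.div_pos hDs hDpos
  obtain ⟨c, hc, hci, hcj, hcs, hrange, hsmall⟩ := exists_mem_range_mul_abs_sum_le hι hd hM hs
    hK.ne' (Nat.mul_div_le _ _) hE h₃
  obtain ⟨r, hru, hrv, hrc⟩ := exists_orthogonal_eq_of_mem_range hrange
  refine ⟨r, ?_, hru, hrv, abs_le_of_maximal_minor (by omega) hM hmax hru hrv (by positivity)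
    fun k hki hkj => hrc k hki hkj ▸ hcs k, ?_⟩
  · obtain ⟨k, hk⟩ := Function.ne_iff.mp hc
    refine Function.ne_iff.mpr ⟨k, ?_⟩
    rwa [hrc k (by rintro rfl; exact hk hci) (by rintro rfl; exact hk hcj)]
  · rw [← minor₂_mul_sum_eq_of_eq_off hru hrv hrc, abs_mul, ← hD] at hsmall
    have hKs : (s : ℝ) ^ d ≤ 2 * (|(D : ℝ)| * (s ^ d / D.natAbs : ℕ)) := by
      have : s ^ d ≤ 2 * (D.natAbs * (s ^ d / D.natAbs)) := by
        nlinarith [Nat.lt_mul_div_succ (s ^ d) hDpos]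
      rw [← Int.cast_abs, ← Nat.cast_natAbs]
      exact_mod_cast this
    calc (s : ℝ) ^ d * |∑ k, (r k : ℝ) * z k|
        ≤ 2 * (|(D : ℝ)| * (s ^ d / D.natAbs : ℕ)) * |∑ k, (r k : ℝ) * z k| := by gcongr
      _ ≤ 6 * (Fintype.card ι * (s * E)) := by linarith

end OrthogonalLattice

section MomentFunctional

variable {R S : Type*} [CommRing R] [CommRing S]

/-- The linear functional on polynomials whose moments are `x`: its value at `X ^ i` is `x i`. -/
noncomputable def momentFunctional (x : ℕ → R) : R[X] →ₗ[R] R :=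
  lsum fun i => x i • LinearMap.id

theorem momentFunctional_monomial (x : ℕ → R) (i : ℕ) (a : R) :
    momentFunctional x (monomial i a) = a * x i := by
  simp [momentFunctional, lsum_apply, mul_comm]

theorem momentFunctional_eq_sum_fin (x : ℕ → R) {P : R[X]} {n : ℕ} (hP : P.natDegree < n) :
    momentFunctional x P = ∑ i : Fin n, P.coeff i * x i := by
  conv_lhs => rw [P.as_sum_range' n hP]
  simp only [map_sum, momentFunctional_monomial, Finset.sum_range]

theorem momentFunctional_X_pow (x : ℕ → R) (i : ℕ) : momentFunctional x (X ^ i) = x i := by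
  rw [X_pow_eq_monomial, momentFunctional_monomial, one_mul]

theorem momentFunctional_X_pow_mul (x : ℕ → R) (j : ℕ) (P : R[X]) :
    momentFunctional x (X ^ j * P) = momentFunctional (fun i => x (i + j)) P := by
  induction P using Polynomial.induction_on' with
  | add P Q hP hQ => rw [mul_add, map_add, map_add, hP, hQ]
  | monomial i a =>
    rw [X_pow_eq_monomial, monomial_mul_monomial, momentFunctional_monomial,
      momentFunctional_monomial, one_mul, add_comm]

theorem momentFunctional_map (f : R →+* S) (x : ℕ → R) (P : R[X]) :
    momentFunctional (fun i => f (x i)) (P.map f) = f (momentFunctional x P) := by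
  induction P using Polynomial.induction_on' with
  | add P Q hP hQ => rw [Polynomial.map_add, map_add, map_add, map_add, hP, hQ]
  | monomial i a => rw [map_monomial, momentFunctional_monomial, momentFunctional_monomial, map_mul]

end MomentFunctional

section CoprimePolynomials

variable {K : Type*} [Field K] {p q : K[X]} {n : ℕ}

theorem exists_mul_add_mul_eq_of_degree_lt (hpq : IsCoprime p q) (hp : p.natDegree ≠ 0)
    (hq : q.natDegree ≤ n) {F : K[X]}
    (hF : F.degree < (p.natDegree + n : ℕ)) :
    ∃ A B : K[X], A.degree < n ∧ B.degree < p.natDegree ∧ F = A * p + B * q := by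
  have hp0 : p ≠ 0 := by rintro rfl; exact hp natDegree_zero
  have hq0 : q ≠ 0 := by
    rintro rfl
    exact hp (natDegree_eq_zero_of_isUnit (isCoprime_zero_right.mp hpq))
  obtain ⟨U, V, hUV⟩ := hpq
  have hB : ((V * F) % p).degree < p.natDegree :=
    degree_eq_natDegree hp0 ▸ EuclideanDomain.mod_lt _ hp0
  have hF' : F = (U * F + q * ((V * F) / p)) * p + (V * F) % p * q := by
    linear_combination (-F) * hUV - q * EuclideanDomain.div_add_mod (V * F) p
  refine ⟨_, _, ?_, hB, hF'⟩
  have hAp : ((U * F + q * ((V * F) / p)) * p).degree < (p.natDegree + n : ℕ) := by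
    rw [eq_sub_of_add_eq hF'.symm]
    refine (degree_sub_le _ _).trans_lt (max_lt hF ?_)
    rw [degree_mul, Nat.cast_add]
    exact WithBot.add_lt_add_of_lt_of_le (by simpa using hq0) hB (degree_le_of_natDegree_le hq)
  rw [degree_mul, degree_eq_natDegree hp0, add_comm, Nat.cast_add] at hAp
  exact (WithBot.add_lt_add_iff_left (by simp)).mp hAp

variable {φ ψ : K[X] →ₗ[K] K}

theorem map_mul_eq_sum_coeff_mul (φ : K[X] →ₗ[K] K) {A : K[X]} (hA : A.degree < n) (p : K[X]) :
    φ (A * p) = ∑ j : Fin n, A.coeff j * φ (X ^ (j : ℕ) * p) := by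
  conv_lhs => rw [← A.sum_C_mul_X_pow_eq, ← A.sum_fin _ (by simp) hA]
  simp only [Finset.sum_mul, map_sum, ← smul_eq_C_mul, smul_mul_assoc, map_smul, smul_eq_mul]

theorem map_mul_eq_zero {A : K[X]} (hA : A.degree < n) (hφ : ∀ j < n, φ (X ^ j * p) = 0) :
    φ (A * p) = 0 := by
  rw [map_mul_eq_sum_coeff_mul φ hA]
  exact Finset.sum_eq_zero fun j _ => by rw [hφ j j.2, mul_zero]

theorem map_eq_zero_of_isCoprime (hpq : IsCoprime p q) (hp : p.natDegree ≠ 0)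
    (hq : q.natDegree ≤ n) (hφp : ∀ j < n, φ (X ^ j * p) = 0)
    (hφq : ∀ j < p.natDegree, φ (X ^ j * q) = 0) {F : K[X]}
    (hF : F.degree < (p.natDegree + n : ℕ)) :
    φ F = 0 := by
  obtain ⟨A, B, hA, hB, rfl⟩ := exists_mul_add_mul_eq_of_degree_lt hpq hp hq hF
  rw [map_add, map_mul_eq_zero hA hφp, map_mul_eq_zero hB hφq, add_zero]

theorem map_eq_coeff_mul_of_isCoprime (hpq : IsCoprime p q) (hp : p.natDegree = n + 1)
    (hq : q.natDegree ≤ n) {F : K[X]} (hF : F.degree < (n + 1 + n : ℕ)) :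
    ∃ b : K, ∀ φ : K[X] →ₗ[K] K, (∀ j < n, φ (X ^ j * p) = 0) → (∀ j < n, φ (X ^ j * q) = 0) →
      φ F = b * φ (X ^ n * q) := by
  obtain ⟨A, B, hA, hB, rfl⟩ :=
    exists_mul_add_mul_eq_of_degree_lt hpq (by omega) hq (hp ▸ hF)
  refine ⟨B.coeff n, fun φ hφp hφq => ?_⟩
  rw [map_add, map_mul_eq_zero hA hφp, zero_add, map_mul_eq_sum_coeff_mul φ (hp ▸ hB),
    Fin.sum_univ_castSucc]
  simp [hφq]

/-- After subtracting a multiple of `p` from `q` to lower its degree, the value at `X ^ n * q`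
determines the functional on all polynomials of degree at most `2 n`. -/
theorem map_mul_map_eq_of_isCoprime (hpq : IsCoprime p q) (hp : p.natDegree = n + 1)
    (hq : q.natDegree ≤ n + 1) (hφp : ∀ j < n, φ (X ^ j * p) = 0)
    (hφq : ∀ j < n, φ (X ^ j * q) = 0) (hψp : ∀ j < n, ψ (X ^ j * p) = 0)
    (hψq : ∀ j < n, ψ (X ^ j * q) = 0) {F G : K[X]} (hF : F.degree < (n + 1 + n : ℕ))
    (hG : G.degree < (n + 1 + n : ℕ)) : φ F * ψ G = ψ F * φ G := by
  set c := q.coeff (n + 1) / p.coeff (n + 1)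
  have hlead : p.coeff (n + 1) ≠ 0 := by
    rw [← hp, coeff_natDegree, leadingCoeff_ne_zero]
    rintro rfl
    simp at hp
  have hq' : (q - C c * p).natDegree ≤ n := by
    refine natDegree_le_pred (n := n + 1) ?_ (by simp [c, hlead])
    exact (natDegree_sub_le _ _).trans (max_le hq ((natDegree_C_mul_le _ _).trans hp.le))
  have hpq' : IsCoprime p (q - C c * p) := by
    simpa [sub_eq_add_neg] using hpq.add_mul_right_right (-C c)
  have hsub {χ : K[X] →ₗ[K] K} (hχp : ∀ j < n, χ (X ^ j * p) = 0)
      (hχq : ∀ j < n, χ (X ^ j * q) = 0) (j : ℕ) (hj : j < n) : χ (X ^ j * (q - C c * p)) = 0 := by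
    rw [mul_sub, mul_left_comm, ← smul_eq_C_mul, map_sub, map_smul, hχp j hj, hχq j hj, smul_zero,
      sub_zero]
  obtain ⟨b, hb⟩ := map_eq_coeff_mul_of_isCoprime hpq' hp hq' hF
  obtain ⟨c, hc⟩ := map_eq_coeff_mul_of_isCoprime hpq' hp hq' hG
  rw [hb φ hφp (hsub hφp hφq), hb ψ hψp (hsub hψp hψq), hc φ hφp (hsub hφp hφq),
    hc ψ hψp (hsub hψp hψq)]
  ring

end CoprimePolynomials

section IntegerMoments

variable {P Q : ℤ[X]} {x y : ℕ → ℤ} {n : ℕ}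

theorem natDegree_map_intCast (P : ℤ[X]) :
    (P.map (Int.castRingHom ℚ)).natDegree = P.natDegree :=
  natDegree_map_eq_of_injective (Int.castRingHom ℚ).injective_int P

theorem momentFunctional_map_eq_zero (h : ∀ j < n, momentFunctional x (X ^ j * P) = 0) :
    ∀ j < n, momentFunctional (fun i => (x i : ℚ)) (X ^ j * P.map (Int.castRingHom ℚ)) = 0 := by
  intro j hj
  have := momentFunctional_map (Int.castRingHom ℚ) x (X ^ j * P)
  rwa [h j hj, map_zero, Polynomial.map_mul, Polynomial.map_pow, map_X] at this

theorem apply_eq_zero_of_momentFunctional_eq_zero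
    (hPQ : IsCoprime (P.map (Int.castRingHom ℚ)) (Q.map (Int.castRingHom ℚ)))
    (hP : P.natDegree ≠ 0) (hQ : Q.natDegree ≤ n)
    (hxP : ∀ j < n, momentFunctional x (X ^ j * P) = 0)
    (hxQ : ∀ j < P.natDegree, momentFunctional x (X ^ j * Q) = 0) {i : ℕ}
    (hi : i < P.natDegree + n) : x i = 0 := by
  rw [← natDegree_map_intCast] at hP hQ hxQ hi
  have := map_eq_zero_of_isCoprime hPQ hP hQ (momentFunctional_map_eq_zero hxP)
    (momentFunctional_map_eq_zero hxQ) (F := X ^ i)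
    (by rwa [degree_X_pow, Nat.cast_lt])
  rw [momentFunctional_X_pow] at this
  exact_mod_cast this

theorem apply_mul_apply_eq_of_momentFunctional_eq_zero
    (hPQ : IsCoprime (P.map (Int.castRingHom ℚ)) (Q.map (Int.castRingHom ℚ)))
    (hP : P.natDegree = n + 1) (hQ : Q.natDegree ≤ n + 1)
    (hxP : ∀ j < n, momentFunctional x (X ^ j * P) = 0)
    (hxQ : ∀ j < n, momentFunctional x (X ^ j * Q) = 0)
    (hyP : ∀ j < n, momentFunctional y (X ^ j * P) = 0)
    (hyQ : ∀ j < n, momentFunctional y (X ^ j * Q) = 0) {i k : ℕ} (hi : i ≤ 2 * n)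
    (hk : k ≤ 2 * n) : x i * y k = y i * x k := by
  rw [← natDegree_map_intCast] at hP hQ
  have := map_mul_map_eq_of_isCoprime hPQ hP hQ (momentFunctional_map_eq_zero hxP)
    (momentFunctional_map_eq_zero hxQ) (momentFunctional_map_eq_zero hyP)
    (momentFunctional_map_eq_zero hyQ) (F := X ^ i) (G := X ^ k)
    (by rw [degree_X_pow, Nat.cast_lt]; omega) (by rw [degree_X_pow, Nat.cast_lt]; omega)
  simp only [momentFunctional_X_pow] at this
  exact_mod_cast this

end IntegerMoments

section LinearPolynomials

variable {a b : ℤ}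

theorem aeval_C_mul_X_sub_C (ξ : ℝ) (a b : ℤ) : aeval ξ (C a * X - C b : ℤ[X]) = ξ * a - b := by
  simp [mul_comm]

theorem C_mul_X_sub_C_ne_zero (ha : a ≠ 0) : (C a * X - C b : ℤ[X]) ≠ 0 := fun h =>
  ha <| by
    simpa only [coeff_sub, coeff_C_mul, coeff_X_one, mul_one, coeff_C_succ, sub_zero, coeff_zero]
      using congrArg (coeff · 1) h

theorem supNorm_C_mul_X_sub_C_le {B : ℝ} (ha : |(a : ℝ)| ≤ B) (hb : |(b : ℝ)| ≤ B) :
    (C a * X - C b : ℤ[X]).supNorm ≤ B := by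
  refine supNorm_le_of_abs_coeff_le fun i => ?_
  rw [coeff_sub, coeff_C_mul, coeff_X, coeff_C]
  rcases i with _ | _ | i
  · simpa using hb
  · simpa using ha
  · simpa using (abs_nonneg _).trans ha

end LinearPolynomials

section Approximations

/-- The nearest integers to `q`, `ξ q`, `ξ² q`, …. -/
noncomputable def nearest (ξ : ℝ) (q : ℕ) (i : ℕ) : ℤ := round (ξ ^ i * q)

/-- The quality `max_{i ≤ n} |ξ ^ i q - y_i|` of the approximation of denominator `q`, where the
numerators `y_i` are the nearest integers. -/
noncomputable def approxError (n : ℕ) (ξ : ℝ) (q : ℕ) : ℝ :=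
  (Finset.range (n + 1)).sup' Finset.nonempty_range_add_one fun i => |ξ ^ i * q - nearest ξ q i|

variable {n : ℕ} {ξ : ℝ} {q : ℕ}

theorem nearest_zero (ξ : ℝ) (q : ℕ) : nearest ξ q 0 = q := by simp [nearest]

theorem abs_pow_mul_sub_nearest_le {i : ℕ} (hi : i ≤ n) :
    |ξ ^ i * q - nearest ξ q i| ≤ approxError n ξ q :=
  Finset.le_sup' (fun i => |ξ ^ i * q - nearest ξ q i|) (Finset.mem_range_succ_iff.mpr hi)

theorem approxError_le {L : ℝ} {y : ℕ → ℤ} (h : ∀ i ≤ n, |ξ ^ i * q - y i| ≤ L) :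
    approxError n ξ q ≤ L :=
  Finset.sup'_le _ _ fun i hi => (round_le _ _).trans (h i (Finset.mem_range_succ_iff.mp hi))

theorem approxError_le_one : approxError n ξ q ≤ 1 :=
  Finset.sup'_le _ _ fun _ _ => (abs_sub_round _).trans (by norm_num)

theorem approxError_nonneg : 0 ≤ approxError n ξ q :=
  (abs_nonneg _).trans (abs_pow_mul_sub_nearest_le n.zero_le)

theorem approxError_pos (hn : n ≠ 0) (hξ : Transcendental ℚ ξ) (hq : q ≠ 0) :
    0 < approxError n ξ q := by
  refine lt_of_lt_of_le ?_ (abs_pow_mul_sub_nearest_le (i := 1) (Nat.one_le_iff_ne_zero.mpr hn))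
  have hne := C_mul_X_sub_C_ne_zero (b := nearest ξ q 1) (Int.natCast_ne_zero.mpr hq)
  simpa only [aeval_C_mul_X_sub_C, pow_one, Int.cast_natCast] using abs_aeval_pos hξ hne

theorem exists_approxError_le_of_simultaneousSolvable {l X : ℝ}
    (h : SimultaneousSolvable n ξ l X) :
    ∃ q : ℕ, q ≠ 0 ∧ q ≤ X ∧ approxError n ξ q ≤ X ^ (-l) := by
  obtain ⟨x, y, hx1, hxX, hy⟩ := h
  lift x to ℕ using by omega
  have hx : x ≠ 0 := by rintro rfl; simp at hx1
  rw [Int.cast_natCast] at hxX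
  refine ⟨x, hx, hxX, ?_⟩
  refine approxError_le (y := fun i => if hi : i - 1 < n ∧ i ≠ 0 then y ⟨i - 1, hi.1⟩ else x)
    fun i hi => ?_
  rcases i with _ | i
  · simpa using Real.rpow_nonneg (x.cast_nonneg.trans hxX) _
  · simpa [Nat.lt_of_succ_le hi] using hy ⟨i, hi⟩

theorem supNorm_X_pow_mul_le (P : ℤ[X]) (j : ℕ) : (X ^ j * P).supNorm ≤ P.supNorm := by
  refine supNorm_le_of_abs_coeff_le fun i => ?_
  rw [coeff_X_pow_mul']
  split_ifs
  · exact abs_coeff_le_supNorm P _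
  · simpa using P.supNorm_nonneg

theorem abs_pow_le_one_add_pow (ξ : ℝ) {i n : ℕ} (h : i ≤ n) : |ξ ^ i| ≤ (1 + |ξ|) ^ n := by
  rw [abs_pow]
  exact (pow_le_pow_left₀ (abs_nonneg ξ) (by linarith) i).trans
    (pow_le_pow_right₀ (by linarith [abs_nonneg ξ]) h)

theorem abs_momentFunctional_nearest_sub_le {P : ℤ[X]} (hP : P.natDegree ≤ n) :
    |(momentFunctional (nearest ξ q) P : ℝ) - q * aeval ξ P| ≤
      (n + 1) * (P.supNorm * approxError n ξ q) := by
  have hsum : (momentFunctional (nearest ξ q) P : ℝ) - q * aeval ξ P =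
      ∑ i : Fin (n + 1), (P.coeff i : ℝ) * (nearest ξ q i - ξ ^ (i : ℕ) * q) := by
    rw [momentFunctional_eq_sum_fin _ (Nat.lt_succ_of_le hP),
      aeval_eq_sum_fin ξ (Nat.lt_succ_of_le hP), Finset.mul_sum]
    push_cast
    rw [← Finset.sum_sub_distrib]
    exact Finset.sum_congr rfl fun i _ => by ring
  rw [hsum, ← Nat.cast_succ, ← Fintype.card_fin n.succ]
  refine abs_sum_mul_le (fun i : Fin (n + 1) => abs_coeff_le_supNorm P i) fun i => ?_
  rw [abs_sub_comm]
  exact abs_pow_mul_sub_nearest_le (Nat.le_of_lt_succ i.2)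

theorem momentFunctional_nearest_X_pow_mul_eq_zero {P : ℤ[X]} {j : ℕ}
    (hj : j + P.natDegree ≤ n)
    (hlt : q * ((1 + |ξ|) ^ n * |aeval ξ P|) + (n + 1) * (P.supNorm * approxError n ξ q) < 1) :
    momentFunctional (nearest ξ q) (X ^ j * P) = 0 := by
  have hdeg : (X ^ j * P).natDegree ≤ n := natDegree_mul_le.trans (by rwa [natDegree_X_pow])
  have hval : |(q : ℝ) * aeval ξ (X ^ j * P)| ≤ q * ((1 + |ξ|) ^ n * |aeval ξ P|) := by
    rw [map_mul, map_pow, aeval_X, abs_mul, abs_mul, Nat.abs_cast]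
    gcongr
    exact abs_pow_le_one_add_pow ξ (by omega)
  have herr : (n + 1) * ((X ^ j * P).supNorm * approxError n ξ q) ≤
      (n + 1) * (P.supNorm * approxError n ξ q) := by
    have := approxError_nonneg (n := n) (ξ := ξ) (q := q)
    gcongr
    exact supNorm_X_pow_mul_le P j
  have hlt1 : |(momentFunctional (nearest ξ q) (X ^ j * P) : ℝ)| < 1 := by
    linarith [abs_momentFunctional_nearest_sub_le (ξ := ξ) (q := q) hdeg,
      abs_sub_abs_le_abs_sub (momentFunctional (nearest ξ q) (X ^ j * P) : ℝ)
        (q * aeval ξ (X ^ j * P))]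
  exact Int.abs_lt_one_iff.mp (by exact_mod_cast hlt1)

end Approximations

section Liouville

theorem abs_det_le_mul_prod_mul_prod {ι : Type*} [Fintype ι] [DecidableEq ι] {A : Matrix ι ι ℝ}
    {r c : ι → ℝ} (h : ∀ i j, |A i j| ≤ r i * c j) :
    |A.det| ≤ (Fintype.card ι).factorial * ((∏ i, r i) * ∏ j, c j) := by
  rw [Matrix.det_apply, ← Fintype.card_perm, Fintype.card, ← nsmul_eq_mul]
  refine (Finset.abs_sum_le_sum_abs _ _).trans (Finset.sum_le_card_nsmul _ _ _ fun σ _ => ?_)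
  calc |Equiv.Perm.sign σ • ∏ i, A (σ i) i| = ∏ i, |A (σ i) i| := by
        rcases Int.units_eq_one_or (Equiv.Perm.sign σ) with hσ | hσ <;> simp [hσ, Finset.abs_prod]
    _ ≤ ∏ i, r (σ i) * c i := Finset.prod_le_prod (fun _ _ => abs_nonneg _) fun i _ => h _ _
    _ = (∏ i, r i) * ∏ j, c j := by rw [Finset.prod_mul_distrib, Equiv.prod_comp σ r]

/-- Adding `ξ ^ i` times the `i`-th row to the row of constant coefficients for every `i ≠ 0` turns
the latter into the row of the values at `ξ`. -/
theorem abs_det_coeff_le {N : ℕ} [NeZero N] {ξ δ : ℝ} {p : Fin N → ℤ[X]} {c : Fin N → ℝ}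
    (hp : ∀ j, (p j).natDegree < N) (hc : ∀ j, (p j).supNorm ≤ c j)
    (hδ : ∀ j, |aeval ξ (p j)| ≤ δ * c j) :
    |((Matrix.of fun i j : Fin N => (p j).coeff i).det : ℝ)| ≤ N.factorial * (δ * ∏ j, c j) := by
  set A : Matrix (Fin N) (Fin N) ℝ := Matrix.of fun i j => ((p j).coeff i : ℝ) with hA
  have hdet : ((Matrix.of fun i j : Fin N => (p j).coeff i).det : ℝ) =
      (A.updateRow 0 (∑ i : Fin N, ξ ^ (i : ℕ) • A i)).det := by
    rw [Matrix.det_updateRow_sum, Fin.val_zero, pow_zero, one_smul, hA]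
    exact (Int.castRingHom ℝ).map_det _
  have hr : (∏ i : Fin N, if i = 0 then δ else 1) = δ := by simp
  have key := abs_det_le_mul_prod_mul_prod (A := A.updateRow 0 (∑ i : Fin N, ξ ^ (i : ℕ) • A i))
    (r := fun i => if i = 0 then δ else 1) (c := c) fun i j => by
      by_cases hi : i = 0
      · subst hi
        have : (∑ i : Fin N, ξ ^ (i : ℕ) • A i) j = aeval ξ (p j) := by
          simp [aeval_eq_sum_fin ξ (hp j), hA, mul_comm]
        simpa [this] using hδ j
      · simpa [Matrix.updateRow_ne hi, hi, hA] using (abs_coeff_le_supNorm (p j) i).trans (hc j)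
  rwa [hr, Fintype.card_fin, ← hdet] at key

variable {ξ δ : ℝ} {P Q : ℤ[X]} {d : ℕ}

theorem sylvester_eq_of_coeff (P Q : ℤ[X]) :
    sylvester P Q P.natDegree Q.natDegree = Matrix.of fun i j : Fin (P.natDegree + Q.natDegree) =>
      (Fin.addCases (fun j => X ^ (j : ℕ) * Q) (fun j => X ^ (j : ℕ) * P) j : ℤ[X]).coeff i := by
  ext i j
  induction j using Fin.addCases with
  | _ j =>
    simp only [sylvester, Matrix.of_apply, Fin.addCases_left, Fin.addCases_right, coeff_X_pow_mul',
      Set.mem_Icc]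
    split_ifs with h₁ h₂ h₂
    · rfl
    · exact absurd h₁.1 h₂
    · exact (coeff_eq_zero_of_natDegree_lt (by omega)).symm
    · rfl

theorem resultant_ne_zero_of_isCoprime_map_rat
    (hPQ : IsCoprime (P.map (Int.castRingHom ℚ)) (Q.map (Int.castRingHom ℚ))) :
    resultant P Q ≠ 0 := by
  have := resultant_ne_zero _ _ hPQ
  rw [natDegree_map_intCast, natDegree_map_intCast, resultant_map_map] at this
  exact fun h => this (by rw [h, map_zero])

theorem one_le_mul_of_isCoprime_of_abs_aeval_le
    (hPQ : IsCoprime (P.map (Int.castRingHom ℚ)) (Q.map (Int.castRingHom ℚ)))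
    (hP : P.natDegree ≠ 0) (hPδ : |aeval ξ P| ≤ δ * P.supNorm)
    (hQδ : |aeval ξ Q| ≤ δ * Q.supNorm) :
    1 ≤ (P.natDegree + Q.natDegree).factorial * ((1 + |ξ|) ^ (P.natDegree + Q.natDegree) * δ *
      (Q.supNorm ^ P.natDegree * P.supNorm ^ Q.natDegree)) := by
  set m := P.natDegree
  set n := Q.natDegree
  have : NeZero (m + n) := ⟨by omega⟩
  have hshift : ∀ {R : ℤ[X]} {j : ℕ}, j < m + n → |aeval ξ R| ≤ δ * R.supNorm →
      |aeval ξ (X ^ j * R)| ≤ (1 + |ξ|) ^ (m + n) * δ * R.supNorm := fun {R j} hj h => by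
    rw [map_mul, map_pow, aeval_X, abs_mul, mul_assoc]
    exact mul_le_mul (abs_pow_le_one_add_pow ξ hj.le) h (abs_nonneg _) (by positivity)
  have hdet := abs_det_coeff_le (ξ := ξ) (δ := (1 + |ξ|) ^ (m + n) * δ)
    (p := Fin.addCases (fun j => X ^ (j : ℕ) * Q) (fun j => X ^ (j : ℕ) * P))
    (c := Fin.addCases (fun _ : Fin m => Q.supNorm) (fun _ : Fin n => P.supNorm))
    (fun j => by
      induction j using Fin.addCases with
      | _ j =>
        simp only [Fin.addCases_left, Fin.addCases_right]
        exact natDegree_mul_le.trans_lt (by rw [natDegree_X_pow]; omega))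
    (fun j => by
      induction j using Fin.addCases with
      | _ j =>
        simpa only [Fin.addCases_left, Fin.addCases_right] using supNorm_X_pow_mul_le _ _)
    (fun j => by
      induction j using Fin.addCases with
      | left j => simpa only [Fin.addCases_left] using hshift (by omega) hQδ
      | right j => simpa only [Fin.addCases_right] using hshift (by omega) hPδ)
  rw [← sylvester_eq_of_coeff, Fin.prod_univ_add] at hdet
  simp only [Fin.addCases_left, Fin.addCases_right, Finset.prod_const, Finset.card_univ,
    Fintype.card_fin] at hdet
  refine le_trans ?_ hdet
  exact_mod_cast Int.one_le_abs (resultant_ne_zero_of_isCoprime_map_rat hPQ)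

theorem one_le_mul_of_isCoprime_of_natDegree_le
    (hPQ : IsCoprime (P.map (Int.castRingHom ℚ)) (Q.map (Int.castRingHom ℚ)))
    (hP : P.natDegree ≠ 0) (hQ : Q ≠ 0) (hPd : P.natDegree ≤ d) (hQd : Q.natDegree ≤ d)
    (hPδ : |aeval ξ P| ≤ δ * P.supNorm) (hQδ : |aeval ξ Q| ≤ δ * Q.supNorm) :
    1 ≤ (2 * d).factorial * ((1 + |ξ|) ^ (2 * d) * δ * (Q.supNorm ^ d * P.supNorm ^ d)) := by
  have hHP := one_le_supNorm (ne_zero_of_natDegree_gt (Nat.pos_of_ne_zero hP))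
  have hHQ := one_le_supNorm hQ
  have hδ : 0 ≤ δ :=
    nonneg_of_mul_nonneg_left ((abs_nonneg _).trans hPδ) (zero_lt_one.trans_le hHP)
  refine (one_le_mul_of_isCoprime_of_abs_aeval_le hPQ hP hPδ hQδ).trans ?_
  gcongr
  · omega
  · linarith [abs_nonneg ξ]
  · omega

end Liouville

section MahlerMeasure

/-- The Mahler measure of an integer polynomial: a multiplicative substitute for its height. -/
noncomputable def intMahler (P : ℤ[X]) : ℝ := (P.map (Int.castRingHom ℂ)).mahlerMeasure

theorem intMahler_mul (P Q : ℤ[X]) : intMahler (P * Q) = intMahler P * intMahler Q := by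
  rw [intMahler, Polynomial.map_mul, mahlerMeasure_mul, intMahler, intMahler]

theorem one_le_intMahler {P : ℤ[X]} (hP : P ≠ 0) : 1 ≤ intMahler P :=
  one_le_mahlerMeasure_of_ne_zero hP

theorem intMahler_nonneg (P : ℤ[X]) : 0 ≤ intMahler P := mahlerMeasure_nonneg _

theorem supNorm_map_complex (P : ℤ[X]) : (P.map (Int.castRingHom ℂ)).supNorm = P.supNorm := by
  simp [supNorm_eq_iSup, Int.norm_eq_abs]

theorem natDegree_map_complex (P : ℤ[X]) : (P.map (Int.castRingHom ℂ)).natDegree = P.natDegree :=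
  natDegree_map_eq_of_injective (Int.castRingHom ℂ).injective_int P

variable {n : ℕ} {ξ c d ω : ℝ} {P Q : ℤ[X]}

theorem intMahler_le (hP : P.natDegree ≤ n) : intMahler P ≤ 2 ^ n * P.supNorm := by
  refine (mahlerMeasure_le_sqrt_natDegree_add_one_mul_supNorm _).trans ?_
  rw [supNorm_map_complex, natDegree_map_complex]
  refine mul_le_mul_of_nonneg_right ((Real.sqrt_le_left (by positivity)).mpr ?_) P.supNorm_nonneg
  calc (P.natDegree : ℝ) + 1 ≤ 2 ^ n := by
        exact_mod_cast (Nat.succ_le_succ hP).trans n.lt_two_pow_self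
    _ ≤ (2 ^ n) ^ 2 := le_self_pow₀ (one_le_pow₀ one_le_two) two_ne_zero

theorem supNorm_le_intMahler (hP : P.natDegree ≤ n) : P.supNorm ≤ 2 ^ n * intMahler P := by
  rw [← supNorm_map_complex]
  refine (supNorm_le_choose_natDegree_div_two_mul_mahlerMeasure _).trans ?_
  rw [natDegree_map_complex]
  refine mul_le_mul_of_nonneg_right ?_ (intMahler_nonneg _)
  exact_mod_cast (Nat.choose_le_two_pow _ _).trans (Nat.pow_le_pow_right two_pos hP)

theorem supNorm_mul_supNorm_le (hPQ : P * Q ≠ 0) (hn : (P * Q).natDegree ≤ n) :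
    P.supNorm * Q.supNorm ≤ 8 ^ n * (P * Q).supNorm := by
  have hdeg := natDegree_mul (left_ne_zero_of_mul hPQ) (right_ne_zero_of_mul hPQ)
  calc P.supNorm * Q.supNorm ≤ (2 ^ n * intMahler P) * (2 ^ n * intMahler Q) :=
        mul_le_mul (supNorm_le_intMahler (by omega)) (supNorm_le_intMahler (by omega))
          Q.supNorm_nonneg (mul_nonneg (by positivity) (intMahler_nonneg _))
    _ = 4 ^ n * intMahler (P * Q) := by
        rw [intMahler_mul, show (4 : ℝ) = 2 * 2 by norm_num, mul_pow]; ring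
    _ ≤ 4 ^ n * (2 ^ n * (P * Q).supNorm) := by gcongr; exact intMahler_le hn
    _ = 8 ^ n * (P * Q).supNorm := by
        rw [← mul_assoc, ← mul_pow]; norm_num

theorem intMahler_rpow_neg_le_abs_aeval (hω : 0 ≤ ω) (hP : P ≠ 0) (hdeg : P.natDegree = 0) :
    intMahler P ^ (-ω) ≤ |aeval ξ P| := by
  refine (Real.rpow_le_one_of_one_le_of_nonpos (one_le_intMahler hP) (by linarith)).trans ?_
  by_contra! h
  exact natDegree_ne_zero_of_abs_aeval_lt_one hP h hdeg

theorem pow_natDegree_mul_intMahler_rpow_neg_le (hω : 0 ≤ ω) (hd₀ : 0 < d) (hd₁ : d ≤ 1)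
    (h : ∀ P : ℤ[X], Irreducible P → P.natDegree ≠ 0 → P.natDegree ≤ n →
      d * intMahler P ^ (-ω) ≤ |aeval ξ P|) :
    ∀ R : ℤ[X], R ≠ 0 → R.natDegree ≤ n →
      d ^ R.natDegree * intMahler R ^ (-ω) ≤ |aeval ξ R| := by
  intro R
  induction R using WfDvdMonoid.induction_on_irreducible with
  | zero => exact fun h => (h rfl).elim
  | unit u hu =>
    intro hu₀ _
    have hdeg := natDegree_eq_zero_of_isUnit hu
    simpa [hdeg] using intMahler_rpow_neg_le_abs_aeval hω hu₀ hdeg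
  | mul a i ha hi ih =>
    intro _ hdeg
    rw [natDegree_mul hi.ne_zero ha] at hdeg
    have hirr : d ^ i.natDegree * intMahler i ^ (-ω) ≤ |aeval ξ i| := by
      have hM : 0 ≤ intMahler i ^ (-ω) := Real.rpow_nonneg (intMahler_nonneg _) _
      by_cases hi₀ : i.natDegree = 0
      · simpa [hi₀] using intMahler_rpow_neg_le_abs_aeval hω hi.ne_zero hi₀
      · exact (mul_le_mul_of_nonneg_right (pow_le_of_le_one hd₀.le hd₁ hi₀) hM).trans
          (h i hi hi₀ (by omega))
    rw [natDegree_mul hi.ne_zero ha, intMahler_mul, map_mul, abs_mul,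
      Real.mul_rpow (intMahler_nonneg _) (intMahler_nonneg _), pow_add, mul_mul_mul_comm]
    exact mul_le_mul hirr (ih ha (by omega))
      (mul_nonneg (by positivity) (Real.rpow_nonneg (intMahler_nonneg _) _)) (abs_nonneg _)

theorem exists_mul_supNorm_rpow_neg_le_abs_aeval (hξ : Transcendental ℚ ξ) (hω : 0 ≤ ω) {H₀ : ℝ}
    (h : ∀ P : ℤ[X], Irreducible P → P.natDegree ≠ 0 → P.natDegree ≤ n → H₀ ≤ P.supNorm →
      P.supNorm ^ (-ω) ≤ |aeval ξ P|) :
    ∃ c : ℝ, 0 < c ∧ ∀ R : ℤ[X], R ≠ 0 → R.natDegree ≤ n →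
      c * R.supNorm ^ (-ω) ≤ |aeval ξ R| := by
  obtain ⟨c, hc, hcle⟩ := exists_forall_le_abs_aeval hξ n H₀
  set K : ℝ := (2 ^ n) ^ (-ω) with hK
  have hK₀ : 0 < K := by positivity
  have hK₁ : K ≤ 1 :=
    Real.rpow_le_one_of_one_le_of_nonpos (one_le_pow₀ one_le_two) (by linarith)
  have hanti {x y : ℝ} (hx : 0 < x) (hxy : x ≤ 2 ^ n * y) : K * y ^ (-ω) ≤ x ^ (-ω) := by
    rw [hK, ← Real.mul_rpow (by positivity) (pos_of_mul_pos_right (hx.trans_le hxy)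
      (by positivity)).le]
    exact Real.rpow_le_rpow_of_nonpos hx hxy (by linarith)
  have hirr : ∀ P : ℤ[X], Irreducible P → P.natDegree ≠ 0 → P.natDegree ≤ n →
      min c 1 * K * intMahler P ^ (-ω) ≤ |aeval ξ P| := by
    intro P hP hP₀ hPn
    have hH := hanti (supNorm_pos hP.ne_zero) (supNorm_le_intMahler hPn)
    have hH₀ : 0 ≤ P.supNorm ^ (-ω) := Real.rpow_nonneg P.supNorm_nonneg _
    have hmin : 0 ≤ min c 1 := le_min hc.le zero_le_one
    rw [mul_assoc]
    refine (mul_le_mul_of_nonneg_left hH hmin).trans ?_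
    rcases le_total H₀ P.supNorm with hbig | hsmall
    · exact (mul_le_of_le_one_left hH₀ (min_le_right c 1)).trans (h P hP hP₀ hPn hbig)
    · have hH₁ : P.supNorm ^ (-ω) ≤ 1 := Real.rpow_le_one_of_one_le_of_nonpos
        (one_le_supNorm hP.ne_zero) (by linarith)
      exact (mul_le_of_le_one_right hmin hH₁).trans
        ((min_le_left c 1).trans (hcle P hP.ne_zero hPn hsmall))
  have hd₀ : 0 < min c 1 * K := by positivity
  have hd₁ : min c 1 * K ≤ 1 := mul_le_one₀ (min_le_right c 1) hK₀.le hK₁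
  refine ⟨(min c 1 * K) ^ n * K, by positivity, fun R hR hRn => le_trans ?_
    (pow_natDegree_mul_intMahler_rpow_neg_le hω hd₀ hd₁ hirr R hR hRn)⟩
  rw [mul_assoc]
  exact mul_le_mul (pow_le_pow_of_le_one hd₀.le hd₁ hRn)
    (hanti (zero_lt_one.trans_le (one_le_intMahler hR)) (intMahler_le hRn))
    (mul_nonneg hK₀.le (Real.rpow_nonneg R.supNorm_nonneg _)) (by positivity)

end MahlerMeasure

section CommonFactors

variable {P Q : ℤ[X]}

theorem isCoprime_map_rat_of_irreducible_of_not_dvd (hP : Irreducible P) (hP₀ : P.natDegree ≠ 0)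
    (h : ¬ P ∣ Q) : IsCoprime (P.map (Int.castRingHom ℚ)) (Q.map (Int.castRingHom ℚ)) := by
  have hprim : P.IsPrimitive := hP.isPrimitive hP₀
  rw [((IsPrimitive.Int.irreducible_iff_irreducible_map_cast hprim).mp hP).coprime_iff_not_dvd]
  exact fun hdvd => h ((IsPrimitive.Int.dvd_iff_map_cast_dvd_map_cast P Q hprim).mpr hdvd)

theorem exists_isPrimitive_map_dvd (g : ℚ[X]) :
    ∃ G : ℤ[X], G.IsPrimitive ∧ G.natDegree = g.natDegree ∧ G.map (Int.castRingHom ℚ) ∣ g := by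
  obtain ⟨b, hb, hbg⟩ := IsLocalization.integerNormalization_spec (nonZeroDivisors ℤ) g
  set G := IsLocalization.integerNormalization (nonZeroDivisors ℤ) g
  have hb₀ : (b : ℚ) ≠ 0 := by exact_mod_cast nonZeroDivisors.ne_zero hb
  have hG : G.map (Int.castRingHom ℚ) = C (b : ℚ) * g := by
    rw [← smul_eq_C_mul, Int.cast_smul_eq_zsmul, ← hbg, algebraMap_int_eq]
  refine ⟨G.primPart, G.isPrimitive_primPart, ?_, ?_⟩
  · rw [natDegree_primPart, ← natDegree_map_intCast, hG, natDegree_C_mul hb₀]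
  · rw [← (isUnit_C.mpr hb₀.isUnit).dvd_mul_left, ← hG]
    exact map_dvd (mapRingHom (Int.castRingHom ℚ)) G.primPart_dvd

theorem exists_dvd_dvd_of_not_isCoprime (hP : P ≠ 0)
    (h : ¬ IsCoprime (P.map (Int.castRingHom ℚ)) (Q.map (Int.castRingHom ℚ))) :
    ∃ G : ℤ[X], G.natDegree ≠ 0 ∧ G ∣ P ∧ G ∣ Q := by
  obtain ⟨g, hg, hgP, hgQ⟩ : ∃ g : ℚ[X], Irreducible g ∧ g ∣ P.map (Int.castRingHom ℚ) ∧
      g ∣ Q.map (Int.castRingHom ℚ) := by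
    by_contra! hcon
    refine h (isCoprime_of_irreducible_dvd (fun h₀ => hP ?_) hcon)
    exact (Polynomial.map_eq_zero_iff (Int.castRingHom ℚ).injective_int).mp h₀.1
  obtain ⟨G, hG, hdeg, hdvd⟩ := exists_isPrimitive_map_dvd g
  exact ⟨G, hdeg ▸ hg.natDegree_pos.ne',
    (IsPrimitive.Int.dvd_iff_map_cast_dvd_map_cast _ _ hG).mpr (hdvd.trans hgP),
    (IsPrimitive.Int.dvd_iff_map_cast_dvd_map_cast _ _ hG).mpr (hdvd.trans hgQ)⟩

end CommonFactors

section LowerDegree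

theorem eventually_mul_rpow_neg_lt (A : ℝ) {δ ε : ℝ} (hδ : 0 < δ) (hε : 0 < ε) :
    ∀ᶠ t : ℝ in atTop, A * t ^ (-δ) < ε := by
  have h := (tendsto_rpow_neg_atTop hδ).const_mul A
  rw [mul_zero] at h
  exact h.eventually_lt_const hε

theorem eventually_lt_mul_rpow_neg {d : ℕ} {ω ε : ℝ} (C : ℝ) (hω : ω < d) (hε : 0 < ε) :
    ∀ᶠ t : ℝ in atTop, ∀ v, v * t ^ d ≤ C → v < ε * t ^ (-ω) := by
  filter_upwards [eventually_mul_rpow_neg_lt C (sub_pos.mpr hω) hε, eventually_gt_atTop 0]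
    with t hlt ht v hv
  have hexp : t ^ ω = t ^ d * t ^ (-(d - ω)) := by
    rw [← Real.rpow_natCast, ← Real.rpow_add ht, neg_sub, add_sub_cancel]
  rw [Real.rpow_neg ht.le, lt_mul_inv_iff₀ (Real.rpow_pos_of_pos ht ω)]
  calc v * t ^ ω = v * t ^ d * t ^ (-(d - ω)) := by rw [hexp, mul_assoc]
    _ ≤ C * t ^ (-(d - ω)) := by gcongr
    _ < ε := hlt

variable {m n : ℕ} {ξ l c ω : ℝ} {P Q : ℤ[X]}

theorem eventually_exists_momentFunctional_eq_zero (hl : 0 < l)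
    (hS : ∀ᶠ X in atTop, SimultaneousSolvable m ξ l X) (hω : 1 < ω * l) :
    ∀ᶠ t : ℝ in atTop, ∃ q : ℕ, q ≠ 0 ∧ ∀ R : ℤ[X], R.supNorm ≤ t →
      |aeval ξ R| ≤ t ^ (-ω) → ∀ j, j + R.natDegree ≤ m →
        momentFunctional (nearest ξ q) (X ^ j * R) = 0 := by
  obtain ⟨ω', hlω', hω'⟩ : ∃ ω', 1 / l < ω' ∧ ω' < ω := exists_between ((div_lt_iff₀ hl).mpr hω)
  rw [div_lt_iff₀ hl] at hlω'
  have hω'0 : 0 < ω' := pos_of_mul_pos_left (zero_lt_one.trans hlω') hl.le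
  filter_upwards [(tendsto_rpow_atTop hω'0).eventually hS, eventually_gt_atTop 0,
    eventually_mul_rpow_neg_lt ((1 + |ξ|) ^ m) (sub_pos.mpr hω') one_half_pos,
    eventually_mul_rpow_neg_lt (m + 1) (sub_pos.mpr hlω') one_half_pos]
    with t hsol ht hval herr
  obtain ⟨q, hq, hqt, hqerr⟩ := exists_approxError_le_of_simultaneousSolvable hsol
  refine ⟨q, hq, fun R hRH hRv j hj => momentFunctional_nearest_X_pow_mul_eq_zero hj ?_⟩
  have hfirst : q * ((1 + |ξ|) ^ m * |aeval ξ R|) < 1 / 2 := by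
    refine lt_of_le_of_lt ?_ hval
    calc q * ((1 + |ξ|) ^ m * |aeval ξ R|) ≤ t ^ ω' * ((1 + |ξ|) ^ m * t ^ (-ω)) := by gcongr
      _ = (1 + |ξ|) ^ m * t ^ (-(ω - ω')) := by
        rw [neg_sub, sub_eq_add_neg, Real.rpow_add ht]; ring
  have hsecond : (m + 1) * (R.supNorm * approxError m ξ q) < 1 / 2 := by
    refine lt_of_le_of_lt ?_ herr
    calc (m + 1) * (R.supNorm * approxError m ξ q)
        ≤ (m + 1) * (t * (t ^ ω') ^ (-l)) := by
          have := approxError_nonneg (n := m) (ξ := ξ) (q := q)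
          gcongr
      _ = (m + 1) * t ^ (-(ω' * l - 1)) := by
        rw [neg_sub, sub_eq_add_neg, Real.rpow_add ht, Real.rpow_one, ← Real.rpow_mul ht.le,
          mul_neg]
  linarith

theorem supNorm_le_of_dvd (hQ : Q ≠ 0) (hPQ : P ∣ Q) (hn : Q.natDegree ≤ n) :
    P.supNorm ≤ 8 ^ n * Q.supNorm := by
  obtain ⟨S, rfl⟩ := hPQ
  exact (le_mul_of_one_le_right P.supNorm_nonneg
    (one_le_supNorm (right_ne_zero_of_mul hQ))).trans (supNorm_mul_supNorm_le hQ hn)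

theorem eventually_exists_polynomial_mul_supNorm_lt (ξ : ℝ) {d : ℕ} (hω₀ : 0 ≤ ω) (hω : ω < d)
    {A : ℝ} (hA : 0 ≤ A) :
    ∀ᶠ t : ℝ in atTop, ∃ Q : ℤ[X], Q ≠ 0 ∧ Q.natDegree ≤ d ∧ A * Q.supNorm < t ∧
      |aeval ξ Q| ≤ t ^ (-ω) := by
  have hd : 0 < (d : ℝ) := hω₀.trans_lt hω
  obtain ⟨C, -, hC⟩ := exists_polynomial_dirichlet (Nat.cast_pos.mp hd).ne' ξ
  filter_upwards [eventually_mul_rpow_neg_lt (A * C) (sub_pos.mpr ((div_lt_one hd).mpr hω)) one_pos,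
    eventually_ge_atTop 1] with t hsmall ht₁
  have ht : 0 < t := zero_lt_one.trans_le ht₁
  obtain ⟨Q, hQ, hQd, hQH, hQv⟩ := hC (t ^ (ω / d)) (Real.one_le_rpow ht₁ (by positivity))
  refine ⟨Q, hQ, hQd, ?_, ?_⟩
  · calc A * Q.supNorm ≤ A * (C * t ^ (ω / d)) := by gcongr
      _ = A * C * t ^ (-(1 - ω / d)) * t := by
        rw [mul_assoc _ _ t, ← Real.rpow_add_one ht.ne', neg_sub, sub_add_cancel, mul_assoc]
      _ < 1 * t := by gcongr
      _ = t := one_mul t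
  · rw [← Real.rpow_mul_natCast ht.le, div_mul_cancel₀ _ hd.ne'] at hQv
    rwa [Real.rpow_neg ht.le, ← one_div, le_div_iff₀ (by positivity)]

theorem exists_supNorm_rpow_neg_le_of_irreducible (hl : 0 < l)
    (hS : ∀ᶠ X in atTop, SimultaneousSolvable (2 * n) ξ l X) (hω₁ : 1 < ω * l) (hω₂ : ω < n + 1) :
    ∃ H₀ : ℝ, ∀ P : ℤ[X], Irreducible P → P.natDegree ≠ 0 → P.natDegree ≤ n → H₀ ≤ P.supNorm →
      P.supNorm ^ (-ω) ≤ |aeval ξ P| := by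
  have hω₀ : 0 < ω := pos_of_mul_pos_left (zero_lt_one.trans hω₁) hl.le
  rw [← Nat.cast_succ] at hω₂
  obtain ⟨H₀, hH₀⟩ := eventually_atTop.mp
    ((eventually_exists_momentFunctional_eq_zero hl hS hω₁).and
      (eventually_exists_polynomial_mul_supNorm_lt ξ hω₀.le hω₂ (A := 8 ^ (n + 1)) (by positivity)))
  refine ⟨H₀, fun P hP hP₀ hPn hPH => ?_⟩
  obtain ⟨⟨q, hq, hvanish⟩, Q, hQ, hQd, hQH, hQv⟩ := hH₀ _ hPH
  by_contra! hlt
  have hndvd : ¬ P ∣ Q := fun hdvd => hQH.not_ge (supNorm_le_of_dvd hQ hdvd hQd)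
  have hQP : Q.supNorm ≤ P.supNorm :=
    (le_mul_of_one_le_left Q.supNorm_nonneg (one_le_pow₀ (by norm_num))).trans hQH.le
  have hzero := apply_eq_zero_of_momentFunctional_eq_zero
    (isCoprime_map_rat_of_irreducible_of_not_dvd hP hP₀ hndvd) hP₀ hQd
    (fun j hj => hvanish P le_rfl hlt.le j (by omega))
    (fun j hj => hvanish Q hQP hQv j (by omega)) (i := 0) (by omega)
  rw [nearest_zero] at hzero
  exact hq (by exact_mod_cast hzero)

theorem mul_rpow_neg_le_abs_aeval_mul (hc : 0 < c) (hω : 0 ≤ ω)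
    (hlow : ∀ R : ℤ[X], R ≠ 0 → R.natDegree ≤ n → c * R.supNorm ^ (-ω) ≤ |aeval ξ R|)
    (hPQ : P * Q ≠ 0) (hP : P.natDegree ≤ n) (hQ : Q.natDegree ≤ n)
    (hm : (P * Q).natDegree ≤ m) :
    c ^ 2 * (8 ^ m) ^ (-ω) * (P * Q).supNorm ^ (-ω) ≤ |aeval ξ (P * Q)| := by
  have hP₀ := left_ne_zero_of_mul hPQ
  have hQ₀ := right_ne_zero_of_mul hPQ
  calc c ^ 2 * (8 ^ m) ^ (-ω) * (P * Q).supNorm ^ (-ω)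
      = c ^ 2 * (8 ^ m * (P * Q).supNorm) ^ (-ω) := by
        rw [Real.mul_rpow (by positivity) (supNorm_nonneg _), mul_assoc]
    _ ≤ c ^ 2 * (P.supNorm * Q.supNorm) ^ (-ω) := by
        refine mul_le_mul_of_nonneg_left (Real.rpow_le_rpow_of_nonpos
          (mul_pos (supNorm_pos hP₀) (supNorm_pos hQ₀)) (supNorm_mul_supNorm_le hPQ hm)
          (by linarith)) (by positivity)
    _ = (c * P.supNorm ^ (-ω)) * (c * Q.supNorm ^ (-ω)) := by
        rw [Real.mul_rpow P.supNorm_nonneg Q.supNorm_nonneg]; ring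
    _ ≤ |aeval ξ P| * |aeval ξ Q| := mul_le_mul (hlow P hP₀ hP) (hlow Q hQ₀ hQ)
        (mul_nonneg hc.le (Real.rpow_nonneg Q.supNorm_nonneg _)) (abs_nonneg _)
    _ = |aeval ξ (P * Q)| := by rw [map_mul, abs_mul]

theorem supNorm_mul_C (P : ℤ[X]) (k : ℤ) : (P * C k).supNorm = P.supNorm * |(k : ℝ)| := by
  simp [supNorm_eq_iSup, Real.iSup_mul_of_nonneg (abs_nonneg (k : ℝ)), Int.norm_eq_abs]

theorem abs_aeval_mul_C (ξ : ℝ) (P : ℤ[X]) (k : ℤ) :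
    |aeval ξ (P * C k)| = |aeval ξ P| * |(k : ℝ)| := by
  simp [abs_mul]

/-- Both the height and the value at `ξ` scale with the constant, but along a minimal pair one
increases and the other decreases. -/
theorem MinimalPair.natDegree_lt_of_dvd_of_dvd {d : ℕ} {N : ℝ} {A : ℤ[X]}
    (h : MinimalPair d ξ N P Q) (hP : A ∣ P) (hQ : A ∣ Q) : A.natDegree < d := by
  obtain ⟨B, rfl⟩ := hP
  obtain ⟨B', rfl⟩ := hQ
  have hdB := h.left_natDegree_le
  have hdB' := h.right_natDegree_le
  rw [natDegree_mul (left_ne_zero_of_mul h.left_ne_zero) (right_ne_zero_of_mul h.left_ne_zero)]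
    at hdB
  rw [natDegree_mul (left_ne_zero_of_mul h.right_ne_zero) (right_ne_zero_of_mul h.right_ne_zero)]
    at hdB'
  by_contra! hA
  have hval := h.abs_aeval_lt
  have hheight := h.left_supNorm_le.trans_lt h.lt_right_supNorm
  rw [eq_C_of_natDegree_eq_zero (show B.natDegree = 0 by omega),
    eq_C_of_natDegree_eq_zero (show B'.natDegree = 0 by omega)] at hval hheight
  rw [abs_aeval_mul_C, abs_aeval_mul_C] at hval
  rw [supNorm_mul_C, supNorm_mul_C] at hheight
  exact (lt_of_mul_lt_mul_left hval (abs_nonneg _)).not_gt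
    (lt_of_mul_lt_mul_left hheight A.supNorm_nonneg)

theorem exists_minimalPair_isCoprime (hc : 0 < c) (hω₀ : 0 ≤ ω) (hω : ω < n + 1)
    (hlow : ∀ R : ℤ[X], R ≠ 0 → R.natDegree ≤ n → c * R.supNorm ^ (-ω) ≤ |aeval ξ R|) :
    ∃ N₁ : ℝ, ∀ N, N₁ ≤ N → ∀ P Q : ℤ[X], MinimalPair (n + 1) ξ N P Q →
      P.natDegree = n + 1 ∧
        IsCoprime (P.map (Int.castRingHom ℚ)) (Q.map (Int.castRingHom ℚ)) := by
  obtain ⟨C, -, hC⟩ := exists_minimalPair_mul_pow_le n.succ_ne_zero ξ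
  rw [← Nat.cast_succ] at hω
  obtain ⟨N₁, hN₁⟩ := eventually_atTop.mp ((eventually_lt_mul_rpow_neg C hω hc).and
    (eventually_lt_mul_rpow_neg C hω (ε := c ^ 2 * (8 ^ (n + 1)) ^ (-ω)) (by positivity)))
  refine ⟨N₁, fun N hN P Q h => ?_⟩
  obtain ⟨hsmall, hsmall'⟩ := hN₁ Q.supNorm (hN.trans h.lt_right_supNorm.le)
  have hdegP := h.left_natDegree_le
  have hpow : Q.supNorm ^ (-ω) ≤ P.supNorm ^ (-ω) := Real.rpow_le_rpow_of_nonpos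
    (supNorm_pos h.left_ne_zero) (h.left_supNorm_le.trans h.lt_right_supNorm.le) (by linarith)
  have hdeg : P.natDegree = n + 1 := by
    by_contra hne
    refine ((hlow P h.left_ne_zero (by omega)).trans_lt (hsmall _ (hC N P Q h))).not_ge ?_
    gcongr
  refine ⟨hdeg, ?_⟩
  by_contra hcop
  obtain ⟨A, hA, hAP, hAQ⟩ := exists_dvd_dvd_of_not_isCoprime h.left_ne_zero hcop
  have hAn := h.natDegree_lt_of_dvd_of_dvd hAP hAQ
  obtain ⟨B, rfl⟩ := hAP
  rw [natDegree_mul (left_ne_zero_of_mul h.left_ne_zero) (right_ne_zero_of_mul h.left_ne_zero)]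
    at hdeg
  refine ((mul_rpow_neg_le_abs_aeval_mul hc hω₀ hlow h.left_ne_zero (by omega) (by omega)
    h.left_natDegree_le).trans_lt (hsmall' _ (hC N _ Q h))).not_ge ?_
  gcongr

end LowerDegree

section ConsecutiveWindows

variable {m : ℕ} {ξ : ℝ} {q : ℕ}

theorem abs_mul_sub_mul_le {a b c d x y : ℝ} (ha : |a| ≤ x) (hb : |b| ≤ y) (hc : |c| ≤ x)
    (hd : |d| ≤ y) : |a * b - c * d| ≤ 2 * (x * y) := by
  have hx : 0 ≤ x := (abs_nonneg _).trans ha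
  calc |a * b - c * d| ≤ |a| * |b| + |c| * |d| := by
        rw [← abs_mul, ← abs_mul]; exact abs_sub _ _
    _ ≤ x * y + x * y := by gcongr
    _ = _ := (two_mul _).symm

theorem abs_minor₃_nearest_le (i j k : Fin m) :
    |minor₃ (fun i : Fin m => ξ ^ (i : ℕ)) (fun i => (nearest ξ q i : ℝ))
      (fun i => (nearest ξ q (i + 1) : ℝ)) i j k| ≤
      6 * (1 + |ξ|) ^ m * approxError m ξ q ^ 2 := by
  set e : ℕ → ℝ := fun i => ξ ^ i * q - nearest ξ q i
  have hnearest (i : ℕ) : (nearest ξ q i : ℝ) = ξ ^ i * q - e i := (sub_sub_cancel _ _).symm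
  have heq : minor₃ (fun i : Fin m => ξ ^ (i : ℕ)) (fun i => (nearest ξ q i : ℝ))
      (fun i => (nearest ξ q (i + 1) : ℝ)) i j k =
        ξ ^ (i : ℕ) * (e j * e (k + 1) - e k * e (j + 1)) +
        ξ ^ (j : ℕ) * (e k * e (i + 1) - e i * e (k + 1)) +
        ξ ^ (k : ℕ) * (e i * e (j + 1) - e j * e (i + 1)) := by
    simp only [minor₃, minor₂, hnearest]
    ring
  have hterm (i j k : Fin m) : |ξ ^ (i : ℕ) * (e j * e (k + 1) - e k * e (j + 1))| ≤
      (1 + |ξ|) ^ m * (2 * (approxError m ξ q * approxError m ξ q)) := by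
    rw [abs_mul]
    exact mul_le_mul (abs_pow_le_one_add_pow ξ i.2.le)
      (abs_mul_sub_mul_le (abs_pow_mul_sub_nearest_le j.2.le) (abs_pow_mul_sub_nearest_le k.2)
        (abs_pow_mul_sub_nearest_le k.2.le) (abs_pow_mul_sub_nearest_le j.2))
      (abs_nonneg _) (by positivity)
  rw [heq]
  linarith [abs_add_three (ξ ^ (i : ℕ) * (e j * e (k + 1) - e k * e (j + 1)))
    (ξ ^ (j : ℕ) * (e k * e (i + 1) - e i * e (k + 1)))
    (ξ ^ (k : ℕ) * (e i * e (j + 1) - e j * e (i + 1))), hterm i j k, hterm j k i, hterm k i j]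

theorem abs_minor₂_nearest_le (hq : q ≠ 0) (i j : Fin m) :
    |((minor₂ (fun i : Fin m => nearest ξ q i) (fun i => nearest ξ q (i + 1)) i j : ℤ) : ℝ)| ≤
      6 * (1 + |ξ|) ^ m * (q * approxError m ξ q) := by
  set e : ℕ → ℝ := fun i => ξ ^ i * q - nearest ξ q i
  set L := approxError m ξ q
  set B := (1 + |ξ|) ^ m
  have hnearest (i : ℕ) : (nearest ξ q i : ℝ) = ξ ^ i * q - e i := (sub_sub_cancel _ _).symm
  have heL {i : ℕ} (hi : i ≤ m) : |e i| ≤ L := abs_pow_mul_sub_nearest_le hi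
  have hpow {i : ℕ} (hi : i ≤ m) : |ξ ^ i| ≤ B := abs_pow_le_one_add_pow ξ hi
  have heq : ((minor₂ (fun i : Fin m => nearest ξ q i) (fun i => nearest ξ q (i + 1)) i j : ℤ) : ℝ)
      = q * (ξ ^ (j : ℕ) * e (i + 1) - ξ ^ (i : ℕ) * e (j + 1)) +
        q * (ξ ^ ((i : ℕ) + 1) * e j - ξ ^ ((j : ℕ) + 1) * e i) +
        (e i * e (j + 1) - e j * e (i + 1)) := by
    simp only [minor₂]
    push_cast
    simp only [hnearest]
    ring
  have h₁ := abs_mul_sub_mul_le (hpow j.2.le) (heL i.2) (hpow i.2.le) (heL j.2)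
  have h₂ := abs_mul_sub_mul_le (hpow i.2) (heL j.2.le) (hpow j.2) (heL i.2.le)
  have h₃ := abs_mul_sub_mul_le (heL i.2.le) (heL j.2) (heL j.2.le) (heL i.2)
  have hLL : L * L ≤ B * (q * L) := by
    have hL₀ : 0 ≤ L := approxError_nonneg
    have hBq : 1 ≤ B * q := one_le_mul_of_one_le_of_one_le
      (one_le_pow₀ (by linarith [abs_nonneg ξ])) (by exact_mod_cast Nat.one_le_iff_ne_zero.mpr hq)
    rw [← mul_assoc]
    exact mul_le_mul_of_nonneg_right (approxError_le_one.trans hBq) hL₀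
  rw [heq]
  refine (abs_add_three _ _ _).trans ?_
  rw [abs_mul, abs_mul, Nat.abs_cast]
  linarith [mul_le_mul_of_nonneg_left h₁ q.cast_nonneg,
    mul_le_mul_of_nonneg_left h₂ q.cast_nonneg]

theorem coeff_dotProduct_eq_momentFunctional {R : Type*} [CommRing R] {P : R[X]}
    (hP : P.natDegree < m) (x : ℕ → R) (s : ℕ) :
    (fun i : Fin m => P.coeff i) ⬝ᵥ (fun i => x (i + s)) = momentFunctional x (X ^ s * P) := by
  rw [momentFunctional_X_pow_mul, momentFunctional_eq_sum_fin _ hP, dotProduct]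

theorem mul_pow_eq_of_minor₂_eq_zero {x : ℕ → ℤ} (hx : x 0 ≠ 0)
    (h : ∀ i j : Fin m, minor₂ (fun i : Fin m => x i) (fun i => x (i + 1)) i j = 0) :
    ∀ j ≤ m, (x 0 : ℚ) * ((x 1 : ℚ) / x 0) ^ j = x j := by
  have hx' : (x 0 : ℚ) ≠ 0 := by exact_mod_cast hx
  intro j hj
  induction j with
  | zero => simp
  | succ j ih =>
    have hminor : (x 0 : ℚ) * x (j + 1) = x j * x 1 := by
      exact_mod_cast sub_eq_zero.mp (h ⟨0, by omega⟩ ⟨j, hj⟩)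
    rw [pow_succ, ← mul_assoc, ih (by omega), ← mul_div_assoc, ← hminor, mul_div_cancel_left₀ _ hx']

theorem exists_minor₂_ne_zero {P Q : ℤ[X]} {x : ℕ → ℤ} (hx : x 0 ≠ 0)
    (hPQ : IsCoprime (P.map (Int.castRingHom ℚ)) (Q.map (Int.castRingHom ℚ)))
    (hP : P.natDegree ≤ m) (hQ : Q.natDegree ≤ m) (hxP : momentFunctional x P = 0)
    (hxQ : momentFunctional x Q = 0) :
    ∃ i j : Fin m, minor₂ (fun i : Fin m => x i) (fun i => x (i + 1)) i j ≠ 0 := by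
  by_contra! hzero
  have hroot {F : ℤ[X]} (hF : F.natDegree ≤ m) (hxF : momentFunctional x F = 0) :
      (F.map (Int.castRingHom ℚ)).eval ((x 1 : ℚ) / x 0) = 0 := by
    refine (mul_eq_zero.mp ?_).resolve_left (show (x 0 : ℚ) ≠ 0 by exact_mod_cast hx)
    rw [← Int.cast_zero, ← hxF, momentFunctional_eq_sum_fin _ (Nat.lt_succ_of_le hF), eval_map,
      eval₂_eq_sum_range' _ (Nat.lt_succ_of_le hF), Finset.sum_range, Finset.mul_sum]
    push_cast
    refine Finset.sum_congr rfl fun i _ => ?_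
    rw [← mul_pow_eq_of_minor₂_eq_zero hx hzero i (Nat.le_of_lt_succ i.2), eq_intCast]
    ring
  obtain ⟨U, V, hUV⟩ := hPQ
  have heval := congrArg (eval ((x 1 : ℚ) / x 0)) hUV
  rw [eval_add, eval_mul, eval_mul, hroot hP hxP, hroot hQ hxQ] at heval
  simp at heval

theorem exists_maximal_minor₂ {ι : Type*} [Finite ι] {u v : ι → ℤ}
    (h : ∃ i j, minor₂ u v i j ≠ 0) :
    ∃ i j, minor₂ u v i j ≠ 0 ∧ ∀ k l, |minor₂ u v k l| ≤ |minor₂ u v i j| := by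
  obtain ⟨i₀, j₀, h₀⟩ := h
  have : Nonempty (ι × ι) := ⟨(i₀, j₀)⟩
  obtain ⟨⟨i, j⟩, hmax⟩ := Finite.exists_max fun p : ι × ι => |minor₂ u v p.1 p.2|
  refine ⟨i, j, fun h => h₀ (abs_nonpos_iff.mp ?_), fun k l => hmax (k, l)⟩
  simpa [h] using hmax (i₀, j₀)

end ConsecutiveWindows

section HeightOfMinimalPairs

variable {n : ℕ} {ξ N l : ℝ} {P Q : ℤ[X]} {q : ℕ}

theorem MinimalPair.abs_aeval_pos {d : ℕ} (h : MinimalPair d ξ N P Q) : 0 < |aeval ξ P| :=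
  (abs_nonneg _).trans_lt h.abs_aeval_lt

theorem MinimalPair.left_supNorm_le_right {d : ℕ} (h : MinimalPair d ξ N P Q) :
    P.supNorm ≤ Q.supNorm :=
  h.left_supNorm_le.trans h.lt_right_supNorm.le

theorem MinimalPair.abs_aeval_le_abs_sum (h : MinimalPair (n + 2) ξ N P Q) {r : Fin (n + 3) → ℤ}
    (hr : r ≠ 0) {B : ℝ} (hB : ∀ i, |(r i : ℝ)| ≤ B) (hBQ : B < Q.supNorm) :
    |aeval ξ P| ≤ |∑ i, (r i : ℝ) * ξ ^ (i : ℕ)| := by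
  rw [← aeval_ofFn]
  exact h.abs_aeval_le _ (ofFn_ne_zero hr) (Nat.le_of_lt_succ (ofFn_natDegree_lt (by omega) r))
    ((supNorm_ofFn_le ((abs_nonneg _).trans (hB 0)) hB).trans_lt hBQ)

/-- A lattice vector orthogonal to the two windows of the approximation is shorter than `Q` when
the maximal minor is small; when that minor is large, `P` itself takes a small value. -/
theorem MinimalPair.pow_mul_abs_aeval_le_of_maximal_minor (h : MinimalPair (n + 2) ξ N P Q)
    {i j : Fin (n + 3)} {E : ℝ} (hE : 0 < E) {s : ℕ} (hs : s ≠ 0)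
    (hsQ : ((n + 3 : ℕ) : ℝ) * s < Q.supNorm)
    (hP : ∀ t < 2, momentFunctional (nearest ξ q) (X ^ t * P) = 0)
    (hM : minor₂ (fun i : Fin (n + 3) => nearest ξ q i) (fun i => nearest ξ q (i + 1)) i j ≠ 0)
    (hmax : ∀ k l, |minor₂ (fun i : Fin (n + 3) => nearest ξ q i)
      (fun i => nearest ξ q (i + 1)) k l| ≤ |minor₂ (fun i : Fin (n + 3) => nearest ξ q i)
      (fun i => nearest ξ q (i + 1)) i j|)
    (h₃ : ∀ k, |minor₃ (fun i : Fin (n + 3) => ξ ^ (i : ℕ)) (fun i => (nearest ξ q i : ℝ))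
      (fun i => (nearest ξ q (i + 1) : ℝ)) k i j| ≤ E) :
    s ^ (n + 1) * |aeval ξ P| ≤ 6 * ((n + 3 : ℕ) * (Q.supNorm * E)) := by
  have hQ₀ := Q.supNorm_nonneg
  rcases le_or_gt |minor₂ (fun i : Fin (n + 3) => nearest ξ q i)
    (fun i => nearest ξ q (i + 1)) i j| ((s : ℤ) ^ (n + 1)) with hle | hlt
  · obtain ⟨r, hr, -, -, hrs, hrz⟩ := exists_short_orthogonal (d := n + 1) (Fintype.card_fin _)
      n.succ_ne_zero hM hmax hE h₃ hle
    rw [Fintype.card_fin] at hrs hrz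
    have hval := h.abs_aeval_le_abs_sum hr (fun i => by exact_mod_cast hrs i) hsQ
    have hsQ' : (s : ℝ) ≤ Q.supNorm := (le_mul_of_one_le_left s.cast_nonneg
      (by exact_mod_cast Nat.succ_pos _)).trans hsQ.le
    calc s ^ (n + 1) * |aeval ξ P| ≤ _ := by gcongr
      _ ≤ _ := hrz
      _ ≤ _ := by gcongr
  · have hPd := Nat.lt_succ_of_le h.left_natDegree_le
    have hval := abs_minor₂_mul_abs_dotProduct_le h₃ (r := fun i => P.coeff i)
      (by rw [← hP 0 two_pos]; exact coeff_dotProduct_eq_momentFunctional hPd _ 0)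
      (by rw [← hP 1 one_lt_two]; exact coeff_dotProduct_eq_momentFunctional hPd _ 1)
      fun i => (abs_coeff_le_supNorm P i).trans h.left_supNorm_le_right
    rw [← aeval_eq_sum_fin ξ hPd, Fintype.card_fin] at hval
    have hlt' : (s : ℝ) ^ (n + 1) ≤ |((minor₂ (fun i : Fin (n + 3) => nearest ξ q i)
        (fun i => nearest ξ q (i + 1)) i j : ℤ) : ℝ)| := by exact_mod_cast hlt.le
    have hnonneg : 0 ≤ (n + 3 : ℕ) * (Q.supNorm * E) := by positivity
    linarith [mul_le_mul_of_nonneg_right hlt' (abs_nonneg (aeval ξ P))]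

theorem MinimalPair.supNorm_pow_mul_abs_aeval_le (hξ : Transcendental ℚ ξ)
    (h : MinimalPair (n + 2) ξ N P Q) (hN : 2 * (n + 3 : ℕ) ≤ N) (hq : q ≠ 0)
    (hPQ : IsCoprime (P.map (Int.castRingHom ℚ)) (Q.map (Int.castRingHom ℚ)))
    (hP : ∀ t < 2, momentFunctional (nearest ξ q) (X ^ t * P) = 0)
    (hQ : momentFunctional (nearest ξ q) Q = 0) :
    Q.supNorm ^ n * |aeval ξ P| ≤
      9 * (4 * (n + 3 : ℕ)) ^ (n + 2) * ((1 + |ξ|) ^ (n + 3) * approxError (n + 3) ξ q ^ 2) := by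
  set k : ℝ := ((n + 3 : ℕ) : ℝ)
  have hk₀ : 0 < k := Nat.cast_pos.mpr (Nat.succ_pos _)
  have hH : 2 * k < Q.supNorm := hN.trans_lt h.lt_right_supNorm
  have hH₀ : 0 < Q.supNorm := (by positivity : 0 < 2 * k).trans hH
  have hfloor : 1 ≤ Q.supNorm / (2 * k) := (one_le_div (by positivity)).mpr hH.le
  set s := ⌊Q.supNorm / (2 * k)⌋₊
  have hs_le : s * (2 * k) ≤ Q.supNorm :=
    (le_div_iff₀ (by positivity)).mp (Nat.floor_le (by positivity))
  have hs₁ : (1 : ℝ) ≤ s := by exact_mod_cast (Nat.one_le_floor_iff _).mpr hfloor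
  have hle_s : Q.supNorm / (4 * k) ≤ s := by
    have : Q.supNorm / (4 * k) = Q.supNorm / (2 * k) / 2 := by field_simp; norm_num
    linarith [Nat.lt_floor_add_one (Q.supNorm / (2 * k))]
  have hx₀ : nearest ξ q 0 ≠ 0 := by rwa [nearest_zero, Nat.cast_ne_zero]
  obtain ⟨i, j, hM, hmax⟩ := exists_maximal_minor₂ (exists_minor₂_ne_zero hx₀ hPQ
    (h.left_natDegree_le.trans (n + 2).le_succ) (h.right_natDegree_le.trans (n + 2).le_succ)
    (by simpa using hP 0 two_pos) hQ)
  have hL : 0 < approxError (n + 3) ξ q := approxError_pos (n + 2).succ_ne_zero hξ hq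
  have hmain := h.pow_mul_abs_aeval_le_of_maximal_minor (by positivity) (s := s)
    (by rintro h0; rw [h0] at hs₁; norm_num at hs₁) (by nlinarith) hP hM hmax
    fun k => abs_minor₃_nearest_le k i j
  refine le_of_mul_le_mul_left ?_ (show 0 < Q.supNorm / (4 * k) ^ (n + 1) by positivity)
  calc Q.supNorm / (4 * k) ^ (n + 1) * (Q.supNorm ^ n * |aeval ξ P|)
      = (Q.supNorm / (4 * k)) ^ (n + 1) * |aeval ξ P| := by rw [div_pow]; ring
    _ ≤ s ^ (n + 1) * |aeval ξ P| := by gcongr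
    _ ≤ _ := hmain
    _ = Q.supNorm / (4 * k) ^ (n + 1) *
        (9 * (4 * k) ^ (n + 2) * ((1 + |ξ|) ^ (n + 3) * approxError (n + 3) ξ q ^ 2)) := by
      rw [pow_succ (4 * k) (n + 1)]; field_simp; ring

end HeightOfMinimalPairs

section CubicPairs

theorem eventually_mul_rpow_lt (C : ℝ) {d : ℕ} {A l ε : ℝ} (hA : 0 ≤ A) (hl : 0 ≤ l)
    (hdl : 1 < d * l) (hε : 0 < ε) :
    ∀ᶠ t : ℝ in atTop, ∀ v, 0 ≤ v → v * t ^ d ≤ C → t * (A * v) ^ l < ε := by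
  filter_upwards [eventually_mul_rpow_neg_lt ((A * C) ^ l) (sub_pos.mpr hdl) hε,
    eventually_gt_atTop 0] with t hlt ht v hv hvC
  have hC : 0 ≤ C := le_trans (by positivity) hvC
  calc t * (A * v) ^ l ≤ t * (A * (C / t ^ d)) ^ l := by
        gcongr
        exact (le_div_iff₀ (by positivity)).mpr hvC
    _ = (A * C) ^ l * t ^ (-(d * l - 1)) := by
        rw [← mul_div_assoc, Real.div_rpow (by positivity) (by positivity), ← Real.rpow_natCast,
          ← Real.rpow_mul ht.le, neg_sub, Real.rpow_sub ht, Real.rpow_one]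
        ring
    _ < ε := hlt

variable {m d : ℕ} {ξ l : ℝ}

theorem momentFunctional_nearest_X_pow_mul_eq_zero_of_le {e H L : ℝ} {q j : ℕ} {R : ℤ[X]}
    (he : 0 < e) (hq : q ≤ (4 * (1 + |ξ|) ^ m * e)⁻¹) (hL : approxError m ξ q ≤ L)
    (hHL : H * L < 1 / (2 * (m + 1))) (hRH : R.supNorm ≤ H) (hRe : |aeval ξ R| ≤ e)
    (hj : j + R.natDegree ≤ m) : momentFunctional (nearest ξ q) (X ^ j * R) = 0 := by
  refine momentFunctional_nearest_X_pow_mul_eq_zero hj ?_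
  have hH : 0 ≤ H := R.supNorm_nonneg.trans hRH
  have hvalue : q * ((1 + |ξ|) ^ m * |aeval ξ R|) ≤ 1 / 4 := by
    calc q * ((1 + |ξ|) ^ m * |aeval ξ R|)
        ≤ (4 * (1 + |ξ|) ^ m * e)⁻¹ * ((1 + |ξ|) ^ m * e) := by gcongr
      _ = 1 / 4 := by field_simp
  have herror : (m + 1) * (R.supNorm * approxError m ξ q) ≤ 1 / 2 := by
    calc (m + 1) * (R.supNorm * approxError m ξ q)
        ≤ (m + 1) * (H * L) := by
          have := approxError_nonneg (n := m) (ξ := ξ) (q := q)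
          gcongr
      _ ≤ (m + 1) * (1 / (2 * (m + 1))) := by gcongr
      _ = 1 / 2 := by field_simp
  linarith

theorem eventually_minimalPair_momentFunctional_eq_zero (ξ : ℝ) (m : ℕ) (hd : 1 < d) (hl : 0 ≤ l)
    (hdl : 1 < d * l) :
    ∀ᶠ N : ℝ in atTop, ∀ P Q : ℤ[X], MinimalPair d ξ N P Q →
      ∃ Y, N ≤ Y ∧ Y ^ (-l) = (4 * (1 + |ξ|) ^ m * |aeval ξ P|) ^ l ∧
        ∀ q : ℕ, q ≤ Y → approxError m ξ q ≤ Y ^ (-l) → ∀ j, j + d ≤ m →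
          momentFunctional (nearest ξ q) (X ^ j * P) = 0 ∧
            momentFunctional (nearest ξ q) (X ^ j * Q) = 0 := by
  obtain ⟨C, -, hC⟩ := exists_minimalPair_mul_pow_le (by omega : d ≠ 0) ξ
  set B := 4 * (1 + |ξ|) ^ m
  have hB : 0 ≤ B := by positivity
  obtain ⟨T, hT⟩ := eventually_atTop.mp ((eventually_mul_rpow_lt C (ε := 1 / (2 * (m + 1))) hB hl
    hdl (by positivity)).and (eventually_mul_rpow_lt C (l := 1) hB zero_le_one
      (by rw [mul_one]; exact_mod_cast hd) one_pos))
  filter_upwards [eventually_ge_atTop T] with N hN P Q h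
  have he := h.abs_aeval_pos
  have hN₀ : 0 < N := (supNorm_pos h.left_ne_zero).trans_le h.left_supNorm_le
  have hBe : 0 < B * |aeval ξ P| := by positivity
  obtain ⟨hsmall, hbound⟩ := hT _ (hN.trans h.lt_right_supNorm.le)
  have hY : ((B * |aeval ξ P|)⁻¹) ^ (-l) = (B * |aeval ξ P|) ^ l := by
    rw [Real.inv_rpow hBe.le, Real.rpow_neg hBe.le, inv_inv]
  refine ⟨(B * |aeval ξ P|)⁻¹, ?_, hY, fun q hq hqe j hj => ⟨?_, ?_⟩⟩
  · specialize hbound _ he.le (hC N P Q h)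
    rw [Real.rpow_one] at hbound
    rw [le_inv_comm₀ hN₀ hBe, ← one_div, le_div_iff₀' hN₀]
    exact (mul_le_mul_of_nonneg_right h.lt_right_supNorm.le hBe.le).trans hbound.le
  · exact momentFunctional_nearest_X_pow_mul_eq_zero_of_le he hq (hqe.trans hY.le)
      (hsmall _ he.le (hC N P Q h)) h.left_supNorm_le_right le_rfl
      (by have := h.left_natDegree_le; omega)
  · exact momentFunctional_nearest_X_pow_mul_eq_zero_of_le he hq (hqe.trans hY.le)
      (hsmall _ he.le (hC N P Q h)) le_rfl h.abs_aeval_lt.le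
      (by have := h.right_natDegree_le; omega)

theorem exists_mul_rpow_neg_le_abs_aeval {n : ℕ} {ω : ℝ} (hξ : Transcendental ℚ ξ) (hl : 0 < l)
    (hS : ∀ᶠ X in atTop, SimultaneousSolvable (2 * n) ξ l X) (hω₁ : 1 / l < ω)
    (hω₂ : ω < n + 1) :
    ∃ c : ℝ, 0 < c ∧ ∀ R : ℤ[X], R ≠ 0 → R.natDegree ≤ n →
      c * R.supNorm ^ (-ω) ≤ |aeval ξ R| := by
  obtain ⟨H₀, hH₀⟩ :=
    exists_supNorm_rpow_neg_le_of_irreducible hl hS ((div_lt_iff₀ hl).mp hω₁) hω₂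
  exact exists_mul_supNorm_rpow_neg_le_abs_aeval hξ ((one_div_pos.mpr hl).trans hω₁).le hH₀

theorem eventually_minimalPair_isCoprime {n : ℕ} (hξ : Transcendental ℚ ξ) (hl : 1 / (n + 1) < l)
    (hS : ∀ᶠ X in atTop, SimultaneousSolvable (2 * n) ξ l X) :
    ∀ᶠ N : ℝ in atTop, ∀ P Q : ℤ[X], MinimalPair (n + 1) ξ N P Q → P.natDegree = n + 1 ∧
      IsCoprime (P.map (Int.castRingHom ℚ)) (Q.map (Int.castRingHom ℚ)) := by
  have hl₀ : 0 < l := lt_trans (by positivity) hl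
  obtain ⟨ω, hω₁, hω₂⟩ := exists_between ((one_div_lt (by positivity) hl₀).mp hl)
  obtain ⟨c, hc, hlow⟩ := exists_mul_rpow_neg_le_abs_aeval hξ hl₀ hS hω₁ hω₂
  obtain ⟨N₁, hN₁⟩ :=
    exists_minimalPair_isCoprime hc ((one_div_pos.mpr hl₀).trans hω₁).le hω₂ hlow
  filter_upwards [eventually_ge_atTop N₁] with N hN using hN₁ N hN

/-- A minimal pair of cubic polynomials whose first member `P` has exact degree three, coprime
over `ℚ`, both orthogonal to every good approximation `nearest ξ q` with `q ≤ Y` and its shift,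
and satisfying two inequalities that bound `|P(ξ)|` in terms of the heights, with constant `K`. -/
structure CubicPair (ξ l K N Y : ℝ) (P Q : ℤ[X]) : Prop extends MinimalPair 3 ξ N P Q where
  left_natDegree : P.natDegree = 3
  isCoprime : IsCoprime (P.map (Int.castRingHom ℚ)) (Q.map (Int.castRingHom ℚ))
  le_bound : N ≤ Y
  momentFunctional_eq_zero : ∀ q : ℕ, q ≤ Y → approxError 4 ξ q ≤ Y ^ (-l) → ∀ j < 2,
    momentFunctional (nearest ξ q) (X ^ j * P) = 0 ∧
      momentFunctional (nearest ξ q) (X ^ j * Q) = 0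
  right_supNorm_le : Q.supNorm ≤ K * |aeval ξ P| ^ (-(1 - 2 * l))
  one_le_mul : 1 ≤ K * (P.supNorm ^ 2 * Q.supNorm ^ 3 * |aeval ξ P|)

variable {N Y K : ℝ} {P Q : ℤ[X]}

theorem MinimalPair.right_supNorm_le_rpow (hξ : Transcendental ℚ ξ) (h : MinimalPair 3 ξ N P Q)
    (hN : 8 ≤ N) (hPQ : IsCoprime (P.map (Int.castRingHom ℚ)) (Q.map (Int.castRingHom ℚ)))
    {B : ℝ} (hB : 0 ≤ B) {q : ℕ} (hq : q ≠ 0) (hqB : approxError 4 ξ q ≤ (B * |aeval ξ P|) ^ l)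
    (hv : ∀ j < 2, momentFunctional (nearest ξ q) (X ^ j * P) = 0 ∧
      momentFunctional (nearest ξ q) (X ^ j * Q) = 0) :
    Q.supNorm ≤
      9 * 16 ^ 3 * ((1 + |ξ|) ^ 4 * (B ^ l) ^ 2) * |aeval ξ P| ^ (-(1 - 2 * l)) := by
  have he := h.abs_aeval_pos
  have key := MinimalPair.supNorm_pow_mul_abs_aeval_le (n := 1) hξ h (by norm_num; linarith) hq
    hPQ (fun t ht => (hv t ht).1) (by simpa using (hv 0 two_pos).2)
  have hpow : ((B * |aeval ξ P|) ^ l) ^ 2 = (B ^ l) ^ 2 * |aeval ξ P| ^ (2 * l) := by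
    rw [Real.mul_rpow hB he.le, mul_pow, ← Real.rpow_mul_natCast he.le, mul_comm l]
    norm_num
  have hsub : |aeval ξ P| ^ (-(1 - 2 * l)) = |aeval ξ P| ^ (2 * l) / |aeval ξ P| := by
    rw [neg_sub, Real.rpow_sub_one he.ne']
  rw [hsub, ← mul_div_assoc, le_div_iff₀ he]
  calc Q.supNorm * |aeval ξ P| ≤ 9 * 16 ^ 3 * ((1 + |ξ|) ^ 4 * approxError 4 ξ q ^ 2) := by
        norm_num at key ⊢
        exact key
    _ ≤ 9 * 16 ^ 3 * ((1 + |ξ|) ^ 4 * ((B * |aeval ξ P|) ^ l) ^ 2) := by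
        have := approxError_nonneg (n := 4) (ξ := ξ) (q := q)
        gcongr
    _ = _ := by rw [hpow]; ring

theorem MinimalPair.one_le_mul_of_isCoprime (h : MinimalPair d ξ N P Q) (hP : P.natDegree ≠ 0)
    (hPQ : IsCoprime (P.map (Int.castRingHom ℚ)) (Q.map (Int.castRingHom ℚ))) (hd : d ≠ 0) :
    1 ≤ (2 * d).factorial * (1 + |ξ|) ^ (2 * d) *
      (P.supNorm ^ (d - 1) * Q.supNorm ^ d * |aeval ξ P|) := by
  have hP₀ := supNorm_pos h.left_ne_zero
  have hvalue : |aeval ξ P| = |aeval ξ P| / P.supNorm * P.supNorm := by field_simp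
  refine (one_le_mul_of_isCoprime_of_natDegree_le hPQ hP h.right_ne_zero h.left_natDegree_le
    h.right_natDegree_le (δ := |aeval ξ P| / P.supNorm) hvalue.le ?_).trans_eq ?_
  · refine h.abs_aeval_lt.le.trans (hvalue.le.trans ?_)
    gcongr
    exact h.left_supNorm_le_right
  · obtain ⟨k, rfl⟩ := Nat.exists_eq_succ_of_ne_zero hd
    rw [Nat.succ_sub_one, pow_succ P.supNorm]
    field_simp

theorem exists_eventually_cubicPair (hξ : Transcendental ℚ ξ) (hl : 1 / 3 < l)
    (hS : ∀ᶠ X in atTop, SimultaneousSolvable 4 ξ l X) :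
    ∃ K, 0 < K ∧ ∀ᶠ N in atTop, ∃ Y P Q, CubicPair ξ l K N Y P Q := by
  set K₁ := 9 * 16 ^ 3 * ((1 + |ξ|) ^ 4 * ((4 * (1 + |ξ|) ^ 4) ^ l) ^ 2)
  set K₂ : ℝ := (2 * 3).factorial * (1 + |ξ|) ^ (2 * 3)
  have hK₂ : 0 < K₂ := by positivity
  obtain ⟨S, hS'⟩ := eventually_atTop.mp hS
  refine ⟨max K₁ K₂, hK₂.trans_le (le_max_right _ _), ?_⟩
  filter_upwards [eventually_ge_atTop 8, eventually_ge_atTop S,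
    eventually_minimalPair_isCoprime (n := 2) hξ (by norm_num; linarith) hS,
    eventually_minimalPair_momentFunctional_eq_zero (d := 3) (l := l) ξ 4 (by norm_num)
      (by linarith) (by push_cast; linarith)] with N hN₈ hNS hcop hvan
  obtain ⟨P, Q, h⟩ := exists_minimalPair three_ne_zero hξ (by linarith : 1 ≤ N)
  obtain ⟨hdeg, hPQ⟩ := hcop P Q h
  obtain ⟨Y, hNY, hY, hv⟩ := hvan P Q h
  obtain ⟨q, hq, hqY, herr⟩ := exists_approxError_le_of_simultaneousSolvable (hS' Y (hNS.trans hNY))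
  refine ⟨Y, P, Q, h, hdeg, hPQ, hNY, fun q hq hq' j hj => hv q hq hq' j (by omega), ?_, ?_⟩
  · refine (h.right_supNorm_le_rpow hξ hN₈ hPQ (by positivity) hq (herr.trans hY.le)
      fun j hj => hv q hqY herr j (by omega)).trans ?_
    gcongr
    exact le_max_left _ _
  · refine (h.one_le_mul_of_isCoprime (by omega) hPQ three_ne_zero).trans ?_
    have := P.supNorm_nonneg
    have := Q.supNorm_nonneg
    gcongr
    exact le_max_right _ _

end CubicPairs

section Exponents

variable {n : ℕ} {ξ l w : ℝ}

theorem SimultaneousSolvable.mono {l' X : ℝ} (h : SimultaneousSolvable n ξ l X) (hX : 1 ≤ X)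
    (hl : l' ≤ l) : SimultaneousSolvable n ξ l' X := by
  obtain ⟨x, y, hx, hxX, hy⟩ := h
  exact ⟨x, y, hx, hxX, fun j =>
    (hy j).trans (Real.rpow_le_rpow_of_exponent_le hX (neg_le_neg hl))⟩

theorem eventually_simultaneousSolvable_mono {l' : ℝ} (hl : l' ≤ l)
    (h : ∀ᶠ X in atTop, SimultaneousSolvable n ξ l X) :
    ∀ᶠ X in atTop, SimultaneousSolvable n ξ l' X := by
  filter_upwards [h, eventually_ge_atTop 1] with X hX hX₁ using hX.mono hX₁ hl

theorem le_of_frequently_le_mul_rpow {A v : ℝ}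
    (h : ∃ᶠ X : ℝ in atTop, X ^ v ≤ A * X ^ w) : v ≤ w := by
  by_contra! hlt
  obtain ⟨X, hX, hsmall, hX₀⟩ := (h.and_eventually ((eventually_mul_rpow_neg_lt A
    (sub_pos.mpr hlt) one_pos).and (eventually_gt_atTop 0))).exists
  refine hX.not_gt ?_
  calc A * X ^ w = A * X ^ (-(v - w)) * X ^ v := by
        rw [mul_assoc, ← Real.rpow_add hX₀]
        congr 2
        ring
    _ < 1 * X ^ v := by gcongr
    _ = X ^ v := one_mul _

theorem uniform_exponent_le (hξ : Transcendental ℚ ξ)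
    (hS : ∀ᶠ X in atTop, SimultaneousSolvable 4 ξ l X) : l ≤ 2 / 5 := by
  by_contra! hl
  obtain ⟨m, hm, hml⟩ := exists_between (lt_min hl (by norm_num : (2 / 5 : ℝ) < 1 / 2))
  obtain ⟨hml, hm₂⟩ := lt_min_iff.mp hml
  have hm₀ : 0 ≤ 1 - 2 * m := by linarith
  obtain ⟨K, hK, hpair⟩ :=
    exists_eventually_cubicPair hξ (by linarith) (eventually_simultaneousSolvable_mono hml.le hS)
  have key : ∃ᶠ H : ℝ in atTop, H ^ (1 : ℝ) ≤ K * K ^ (1 - 2 * m) * H ^ (5 * (1 - 2 * m)) := by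
    refine frequently_atTop.mpr fun T => ?_
    obtain ⟨N, ⟨Y, P, Q, h⟩, hNT⟩ := (hpair.and (eventually_ge_atTop T)).exists
    have he := h.abs_aeval_pos
    have hQ := supNorm_pos h.right_ne_zero
    have hinv : |aeval ξ P|⁻¹ ≤ K * Q.supNorm ^ 5 := by
      rw [inv_eq_one_div, div_le_iff₀ he]
      calc 1 ≤ K * (P.supNorm ^ 2 * Q.supNorm ^ 3 * |aeval ξ P|) := h.one_le_mul
        _ ≤ K * (Q.supNorm ^ 2 * Q.supNorm ^ 3 * |aeval ξ P|) := by
          have := P.supNorm_nonneg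
          have := h.left_supNorm_le_right
          gcongr
        _ = K * Q.supNorm ^ 5 * |aeval ξ P| := by ring
    refine ⟨Q.supNorm, hNT.trans h.lt_right_supNorm.le, ?_⟩
    calc Q.supNorm ^ (1 : ℝ) ≤ K * |aeval ξ P| ^ (-(1 - 2 * m)) := by
          rw [Real.rpow_one]
          exact h.right_supNorm_le
      _ ≤ K * (K * Q.supNorm ^ 5) ^ (1 - 2 * m) := by
          rw [Real.rpow_neg he.le, ← Real.inv_rpow he.le]
          gcongr
      _ = K * K ^ (1 - 2 * m) * Q.supNorm ^ (5 * (1 - 2 * m)) := by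
          rw [Real.mul_rpow hK.le (by positivity), ← Real.rpow_natCast_mul hQ.le, mul_assoc]
          norm_num
  linarith [le_of_frequently_le_mul_rpow key]

theorem CubicPair.one_le_mul_rpow {K N Y : ℝ} {P Q : ℤ[X]} (hK : 0 < K)
    (h : CubicPair ξ l K N Y P Q) :
    1 ≤ K ^ 4 * N ^ 2 * |aeval ξ P| ^ (6 * l - 2) := by
  have he := h.abs_aeval_pos
  have hP := P.supNorm_nonneg
  have hQ := Q.supNorm_nonneg
  calc 1 ≤ K * (P.supNorm ^ 2 * Q.supNorm ^ 3 * |aeval ξ P|) := h.one_le_mul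
    _ ≤ K * (N ^ 2 * (K * |aeval ξ P| ^ (-(1 - 2 * l))) ^ 3 * |aeval ξ P|) := by
      have := h.left_supNorm_le
      have := h.right_supNorm_le
      gcongr
    _ = K ^ 4 * N ^ 2 * ((|aeval ξ P| ^ (-(1 - 2 * l))) ^ 3 * |aeval ξ P|) := by ring
    _ = K ^ 4 * N ^ 2 * |aeval ξ P| ^ (6 * l - 2) := by
      rw [← Real.rpow_mul_natCast he.le, ← Real.rpow_add_one he.ne']
      congr 2
      push_cast
      ring

theorem cubic_exponent_le (hξ : Transcendental ℚ ξ) (hl : 1 / 3 < l)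
    (hS : ∀ᶠ X in atTop, SimultaneousSolvable 4 ξ l X)
    (hw : ∃ᶠ X in atTop, LinearFormSolvable 3 ξ w X) : w ≤ 1 / (3 * l - 1) := by
  have hl₀ : 0 < 3 * l - 1 := by linarith
  rcases lt_or_ge w 0 with hw₀ | hw₀
  · exact hw₀.le.trans (by positivity)
  obtain ⟨A, hA₁, hA⟩ := exists_polynomial_of_linearFormSolvable 3 ξ
  obtain ⟨K, hK, hpair⟩ := exists_eventually_cubicPair hξ hl hS
  obtain ⟨T, hT⟩ := eventually_atTop.mp hpair
  have key : ∃ᶠ X : ℝ in atTop, X ^ (w * (6 * l - 2)) ≤ K ^ 4 * A ^ 2 * X ^ (2 : ℝ) := by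
    refine (hw.and_eventually ((eventually_ge_atTop 1).and (eventually_ge_atTop T))).mono ?_
    rintro X ⟨hX, hX₁, hXT⟩
    have hX₀ : 0 < X := by linarith
    obtain ⟨R, hR₀, hRd, hRH, hRv⟩ := hA w X hw₀ hX₁ hX
    obtain ⟨Y, P, Q, h⟩ := hT (A * X) (hXT.trans (le_mul_of_one_le_left hX₀.le hA₁))
    have hPv : |aeval ξ P| ≤ X ^ (-w) :=
      (h.abs_aeval_le R hR₀ hRd (hRH.trans_lt h.lt_right_supNorm)).trans hRv
    have hpow : |aeval ξ P| ^ (6 * l - 2) ≤ (X ^ (w * (6 * l - 2)))⁻¹ := by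
      rw [← Real.rpow_neg hX₀.le, ← neg_mul, Real.rpow_mul hX₀.le]
      have : 0 ≤ 6 * l - 2 := by linarith
      gcongr
    have hone : 1 ≤ K ^ 4 * (A * X) ^ 2 * (X ^ (w * (6 * l - 2)))⁻¹ :=
      (h.one_le_mul_rpow hK).trans (by gcongr)
    rw [← div_eq_mul_inv, one_le_div (by positivity)] at hone
    rw [Real.rpow_two]
    linarith
  rw [le_div_iff₀ hl₀]
  linarith [le_of_frequently_le_mul_rpow key]

theorem linearForm_exponent_le (hξ : Transcendental ℚ ξ) (hl : 1 / (n + 1) < l)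
    (hS : ∀ᶠ X in atTop, SimultaneousSolvable (2 * n) ξ l X)
    (hw : ∃ᶠ X in atTop, LinearFormSolvable n ξ w X) : w ≤ 1 / l := by
  by_contra! hlt
  have hl₀ : 0 < l := lt_trans (by positivity) hl
  obtain ⟨ω, hω, hωw⟩ := exists_between (lt_min hlt ((one_div_lt (by positivity) hl₀).mp hl))
  obtain ⟨hωw, hωn⟩ := lt_min_iff.mp hωw
  have hω₀ : 0 < ω := (one_div_pos.mpr hl₀).trans hω
  obtain ⟨c, hc, hlow⟩ := exists_mul_rpow_neg_le_abs_aeval hξ hl₀ hS hω hωn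
  obtain ⟨A, hA₁, hA⟩ := exists_polynomial_of_linearFormSolvable n ξ
  have hA₀ : 0 < A := by linarith
  have key : ∃ᶠ X : ℝ in atTop, X ^ (-ω) ≤ (c * A ^ (-ω))⁻¹ * X ^ (-w) := by
    refine (hw.and_eventually (eventually_ge_atTop 1)).mono ?_
    rintro X ⟨hX, hX₁⟩
    obtain ⟨R, hR₀, hRd, hRH, hRv⟩ := hA w X (hω₀.trans hωw).le hX₁ hX
    rw [le_inv_mul_iff₀ (by positivity), mul_assoc, ← Real.mul_rpow hA₀.le (by linarith)]
    calc c * (A * X) ^ (-ω) ≤ c * R.supNorm ^ (-ω) := by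
          have := Real.rpow_le_rpow_of_nonpos (supNorm_pos hR₀) hRH (neg_nonpos.mpr hω₀.le)
          exact mul_le_mul_of_nonneg_left this hc.le
      _ ≤ X ^ (-w) := (hlow R hR₀ hRd).trans hRv
  linarith [le_of_frequently_le_mul_rpow key]

theorem eventually_linearFormSolvable (hξ : Transcendental ℚ ξ) (hl : 1 / 3 < l) (hl₂ : l < 1 / 2)
    (hS : ∀ᶠ X in atTop, SimultaneousSolvable 4 ξ l X) (hw : w < 1 / (1 - 2 * l)) :
    ∀ᶠ X in atTop, LinearFormSolvable 3 ξ w X := by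
  obtain ⟨K, hK, hpair⟩ := exists_eventually_cubicPair hξ hl hS
  have hl₀ : 0 < 1 - 2 * l := by linarith
  filter_upwards [hpair, eventually_gt_atTop 0, eventually_mul_rpow_neg_lt (K ^ (1 / (1 - 2 * l)))
    (sub_pos.mpr hw) one_pos] with X ⟨Y, P, Q, h⟩ hX hsmall
  have he := h.abs_aeval_pos
  have hpow : |aeval ξ P| ^ (1 - 2 * l) ≤ K / X := by
    have := h.lt_right_supNorm.le.trans h.right_supNorm_le
    rw [Real.rpow_neg he.le, ← div_eq_mul_inv, le_div_iff₀ (by positivity)] at this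
    rwa [le_div_iff₀' hX]
  refine linearFormSolvable_of_polynomial (by rw [h.left_natDegree]; norm_num)
    h.left_natDegree.le h.left_supNorm_le ?_
  calc |aeval ξ P| = (|aeval ξ P| ^ (1 - 2 * l)) ^ (1 / (1 - 2 * l)) := by
        rw [← Real.rpow_mul he.le, mul_one_div_cancel hl₀.ne', Real.rpow_one]
    _ ≤ (K / X) ^ (1 / (1 - 2 * l)) := by gcongr
    _ = K ^ (1 / (1 - 2 * l)) * X ^ (-(1 / (1 - 2 * l) - w)) * X ^ (-w) := by
        rw [Real.div_rpow hK.le hX.le, mul_assoc, ← Real.rpow_add hX, div_eq_mul_inv,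
          ← Real.rpow_neg hX.le]
        congr 2
        ring
    _ ≤ 1 * X ^ (-w) := by gcongr
    _ = X ^ (-w) := one_mul _

theorem frequently_linearFormSolvable_of_rpow {A α β : ℝ} (hA : 0 < A) (hα : 0 < α) (hβ : 0 < β)
    (hw : w * α < β)
    (h : ∃ᶠ y : ℝ in atTop, ∃ P : ℤ[X], P ≠ 0 ∧ P.natDegree ≤ n ∧ P.supNorm ≤ A * y ^ α ∧
      |aeval ξ P| ≤ A * y ^ (-β)) :
    ∃ᶠ X in atTop, LinearFormSolvable n ξ w X := by
  have hmap : Tendsto (fun y : ℝ => A * y ^ α) atTop atTop :=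
    (tendsto_rpow_atTop hα).const_mul_atTop hA
  refine hmap.frequently ((h.and_eventually ((eventually_gt_atTop 0).and
    ((eventually_mul_rpow_neg_lt A hβ one_pos).and (eventually_mul_rpow_neg_lt (A * A ^ w)
      (sub_pos.mpr hw) one_pos)))).mono ?_)
  rintro y ⟨⟨P, hP, hd, hH, hv⟩, hy, hβ', hw'⟩
  refine linearFormSolvable_of_polynomial
    (natDegree_ne_zero_of_abs_aeval_lt_one hP (hv.trans_lt hβ')) hd hH (hv.trans ?_)
  have hsplit : y ^ (-β) = y ^ (-(β - w * α)) * (y ^ α) ^ (-w) := by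
    rw [← Real.rpow_mul hy.le, ← Real.rpow_add hy]
    congr 1
    ring
  calc A * y ^ (-β) = A * A ^ w * y ^ (-(β - w * α)) * (A * y ^ α) ^ (-w) := by
        rw [hsplit, Real.mul_rpow hA.le (by positivity), Real.rpow_neg hA.le]
        field_simp
    _ ≤ 1 * (A * y ^ α) ^ (-w) := by gcongr
    _ = (A * y ^ α) ^ (-w) := one_mul _

end Exponents

section OrdinaryExponent

variable {n : ℕ} {ξ l m w c : ℝ} {q : ℕ}

theorem exists_le_supNorm_pow_mul_abs_aeval (hξ : Transcendental ℚ ξ) (hl : 1 / (n + 1) < l)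
    (hS : ∀ᶠ X in atTop, SimultaneousSolvable (2 * n) ξ l X) :
    ∃ c : ℝ, 0 < c ∧ ∀ R : ℤ[X], R ≠ 0 → R.natDegree ≤ n →
      c ≤ R.supNorm ^ (n + 1) * |aeval ξ R| := by
  have hl₀ : 0 < l := lt_trans (by positivity) hl
  obtain ⟨ω, hω₁, hω₂⟩ := exists_between ((one_div_lt (by positivity) hl₀).mp hl)
  obtain ⟨c, hc, hlow⟩ := exists_mul_rpow_neg_le_abs_aeval hξ hl₀ hS hω₁ hω₂
  refine ⟨c, hc, fun R hR hRd => ?_⟩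
  have hR₁ := one_le_supNorm hR
  have hone : 1 ≤ R.supNorm ^ (n + 1) * R.supNorm ^ (-ω) := by
    rw [← Real.rpow_natCast, ← Real.rpow_add (by linarith)]
    exact Real.one_le_rpow hR₁ (by push_cast; linarith)
  calc c ≤ c * (R.supNorm ^ (n + 1) * R.supNorm ^ (-ω)) := le_mul_of_one_le_right hc.le hone
    _ = R.supNorm ^ (n + 1) * (c * R.supNorm ^ (-ω)) := by ring
    _ ≤ R.supNorm ^ (n + 1) * |aeval ξ R| := by gcongr; exact hlow R hR hRd

theorem frequently_approxError_le (hn : n ≠ 0) (hξ : Transcendental ℚ ξ) (hm : 0 < m)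
    (h : ∃ᶠ X in atTop, SimultaneousSolvable n ξ m X) :
    ∃ᶠ q : ℕ in atTop, approxError n ξ q ≤ q ^ (-m) := by
  refine frequently_atTop.mpr fun T => ?_
  have hsmall : ∀ᶠ X : ℝ in atTop, ∀ q ∈ (Finset.range T).erase 0,
      X ^ (-m) < approxError n ξ q := by
    refine (eventually_all_finset _).mpr fun q hq => ?_
    simpa using eventually_mul_rpow_neg_lt 1 hm (approxError_pos hn hξ (Finset.ne_of_mem_erase hq))
  obtain ⟨X, hX, hsmall⟩ := (h.and_eventually hsmall).exists
  obtain ⟨q, hq, hqX, herr⟩ := exists_approxError_le_of_simultaneousSolvable hX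
  refine ⟨q, ?_, herr.trans (Real.rpow_le_rpow_of_nonpos (by positivity) hqX (by linarith))⟩
  by_contra! hqT
  exact (hsmall q (Finset.mem_erase.mpr ⟨hq, Finset.mem_range.mpr hqT⟩)).not_ge herr

theorem exists_eq_mul_pow_le {x y z : ℤ} (hx : 0 < x) (h : x ^ n * z = y ^ (n + 1)) :
    ∃ g u v : ℤ, 0 < g ∧ 0 < v ∧ x = g * v ∧ y = g * u ∧ v ^ n ≤ g := by
  obtain ⟨g, v, u, hg, hcop, hv, hu⟩ := Int.exists_gcd_one' (Int.gcd_pos_of_ne_zero_left y hx.ne')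
  have hg' : 0 < (g : ℤ) := by exact_mod_cast hg
  subst hv hu
  have hdvd : v ^ n ∣ (g : ℤ) := by
    have heq : (g : ℤ) ^ n * (v ^ n * z) = g ^ n * (g * u ^ (n + 1)) := by linear_combination h
    exact (Int.isCoprime_iff_gcd_eq_one.mpr hcop).pow.dvd_of_dvd_mul_right
      ⟨z, (mul_left_cancel₀ (by positivity) heq).symm⟩
  exact ⟨g, u, v, hg', pos_of_mul_pos_left hx hg'.le, mul_comm _ _, mul_comm _ _,
    Int.le_of_dvd hg' hdvd⟩

theorem abs_nearest_one_le (hq : q ≠ 0) : |(nearest ξ q 1 : ℝ)| ≤ (1 + |ξ|) * q := by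
  have hq₁ : (1 : ℝ) ≤ q := by exact_mod_cast Nat.one_le_iff_ne_zero.mpr hq
  have herr := (abs_pow_mul_sub_nearest_le le_rfl).trans (approxError_le_one (n := 1) (ξ := ξ)
    (q := q))
  rw [pow_one, abs_sub_comm] at herr
  have htri := abs_sub_abs_le_abs_sub (nearest ξ q 1 : ℝ) (ξ * q)
  rw [abs_mul, Nat.abs_cast] at htri
  linarith

theorem exists_minor₂_nearest_ne_zero
    (hlow : ∀ R : ℤ[X], R ≠ 0 → R.natDegree ≤ 1 → c ≤ R.supNorm ^ n * |aeval ξ R|) (hq : q ≠ 0)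
    (hlt : (1 + |ξ|) ^ n * approxError (n + 1) ξ q < c) :
    ∃ i j : Fin (n + 1),
      minor₂ (fun i : Fin (n + 1) => nearest ξ q i) (fun i => nearest ξ q (i + 1)) i j ≠ 0 := by
  by_contra! hzero
  have hx : 0 < nearest ξ q 0 := by rw [nearest_zero]; exact_mod_cast Nat.pos_of_ne_zero hq
  have hx' : (nearest ξ q 0 : ℚ) ≠ 0 := by exact_mod_cast hx.ne'
  have hpow : nearest ξ q 0 ^ n * nearest ξ q (n + 1) = nearest ξ q 1 ^ (n + 1) := by
    have := mul_pow_eq_of_minor₂_eq_zero hx.ne' hzero (n + 1) le_rfl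
    rw [div_pow] at this
    field_simp at this
    rw [pow_succ' (nearest ξ q 0 : ℚ), mul_assoc] at this
    exact_mod_cast (mul_left_cancel₀ hx' this).symm
  obtain ⟨g, u, v, hg, hv, hxg, hyg, hvg⟩ := exists_eq_mul_pow_le hx hpow
  have hg' : (0 : ℝ) < g := by exact_mod_cast hg
  have hv' : (0 : ℝ) < v := by exact_mod_cast hv
  have hvg' : (v : ℝ) ^ n ≤ g := by exact_mod_cast hvg
  have hqg : (q : ℝ) = g * v := by rw [nearest_zero] at hxg; exact_mod_cast hxg
  have hu : |(u : ℝ)| ≤ (1 + |ξ|) * v := by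
    have := abs_nearest_one_le (ξ := ξ) hq
    rw [hyg, hqg, Int.cast_mul, abs_mul, abs_of_pos hg', mul_left_comm] at this
    exact le_of_mul_le_mul_left this hg'
  have hval : g * |ξ * v - u| ≤ approxError (n + 1) ξ q := by
    have := abs_pow_mul_sub_nearest_le (ξ := ξ) (q := q) (Nat.le_add_left 1 n)
    rw [hyg, hqg, Int.cast_mul, pow_one, mul_left_comm, ← mul_sub, abs_mul, abs_of_pos hg'] at this
    exact this
  have hlin := hlow (C v * X - C u) (C_mul_X_sub_C_ne_zero hv.ne') (by compute_degree)
  rw [aeval_C_mul_X_sub_C] at hlin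
  refine (hlin.trans ?_).not_gt hlt
  have hH : (C v * X - C u : ℤ[X]).supNorm ≤ (1 + |ξ|) * v :=
    supNorm_C_mul_X_sub_C_le (by rw [abs_of_pos hv']; nlinarith [abs_nonneg ξ]) hu
  calc (C v * X - C u : ℤ[X]).supNorm ^ n * |ξ * v - u|
      ≤ ((1 + |ξ|) * v) ^ n * |ξ * v - u| := by
        have := (C v * X - C u : ℤ[X]).supNorm_nonneg
        gcongr
    _ = (1 + |ξ|) ^ n * (v ^ n * |ξ * v - u|) := by rw [mul_pow, mul_assoc]
    _ ≤ (1 + |ξ|) ^ n * (g * |ξ * v - u|) := by gcongr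
    _ ≤ (1 + |ξ|) ^ n * approxError (n + 1) ξ q := by gcongr

theorem exists_polynomial_momentFunctional_eq_zero (hξ : Transcendental ℚ ξ) (hq : q ≠ 0)
    (h : ∃ i j : Fin 4,
      minor₂ (fun i : Fin 4 => nearest ξ q i) (fun i => nearest ξ q (i + 1)) i j ≠ 0) :
    ∃ P : ℤ[X], P ≠ 0 ∧ P.natDegree ≤ 3 ∧ momentFunctional (nearest ξ q) P = 0 ∧
      P.supNorm ≤ 8 * √(6 * (1 + |ξ|) ^ 4 * (q * approxError 4 ξ q)) := by
  obtain ⟨i, j, hM, hmax⟩ := exists_maximal_minor₂ h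
  set M := |((minor₂ (fun i : Fin 4 => nearest ξ q i) (fun i => nearest ξ q (i + 1)) i j : ℤ) : ℝ)|
    with hMdef
  have hM₁ : 1 ≤ √M := Real.one_le_sqrt.mpr (by rw [hMdef]; exact_mod_cast Int.one_le_abs hM)
  obtain ⟨s, hMs, hs⟩ : ∃ s : ℕ, M ≤ (s : ℝ) ^ 2 ∧ (s : ℝ) ≤ 2 * √M :=
    ⟨⌈√M⌉₊, (Real.sqrt_le_left (by positivity)).mp (Nat.le_ceil _),
      by linarith [Nat.ceil_lt_add_one (Real.sqrt_nonneg M)]⟩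
  rw [hMdef] at hMs
  have hL := approxError_pos four_ne_zero hξ hq
  obtain ⟨r, hr, hru, -, hrs, -⟩ := exists_short_orthogonal (d := 2) (Fintype.card_fin 4)
    two_ne_zero
    hM hmax (show 0 < 6 * (1 + |ξ|) ^ 4 * approxError 4 ξ q ^ 2 by positivity)
    (fun k => abs_minor₃_nearest_le k i j) (s := s) (by exact_mod_cast hMs)
  refine ⟨ofFn 4 r, ofFn_ne_zero hr, Nat.le_of_lt_succ (ofFn_natDegree_lt (by norm_num) r), ?_, ?_⟩
  · rw [momentFunctional_eq_sum_fin _ (ofFn_natDegree_lt (by norm_num) r), ← hru, dotProduct]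
    exact Finset.sum_congr rfl fun k _ => by simp
  · have hle : √M ≤ √(6 * (1 + |ξ|) ^ 4 * (q * approxError 4 ξ q)) :=
      Real.sqrt_le_sqrt (abs_minor₂_nearest_le hq i j)
    refine supNorm_ofFn_le (by positivity) fun k => ?_
    have : |(r k : ℝ)| ≤ 4 * s := by exact_mod_cast hrs k
    linarith

theorem abs_aeval_le_of_momentFunctional_eq_zero (hq : q ≠ 0) {P : ℤ[X]} (hP : P.natDegree ≤ n)
    (h : momentFunctional (nearest ξ q) P = 0) :
    |aeval ξ P| ≤ (n + 1) * (P.supNorm * approxError n ξ q) / q := by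
  rw [le_div_iff₀' (by exact_mod_cast Nat.pos_of_ne_zero hq)]
  simpa [h, abs_mul] using abs_momentFunctional_nearest_sub_le (ξ := ξ) (q := q) hP

theorem sqrt_mul_le_rpow {x e m : ℝ} (hx : 0 < x) (he : e ≤ x ^ (-m)) :
    √(x * e) ≤ x ^ ((1 - m) / 2) := by
  rw [Real.sqrt_le_left (by positivity), ← Real.rpow_mul_natCast hx.le, Nat.cast_ofNat,
    div_mul_cancel₀ _ two_ne_zero, sub_eq_add_neg, Real.rpow_add hx, Real.rpow_one]
  gcongr

theorem frequently_linearFormSolvable_of_frequently (hξ : Transcendental ℚ ξ) (hl : 1 / 3 < l)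
    (hS : ∀ᶠ X in atTop, SimultaneousSolvable 4 ξ l X) (hm₀ : 0 < m) (hm₁ : m < 1)
    (h : ∃ᶠ X in atTop, SimultaneousSolvable 4 ξ m X) (hw : w * (1 - m) < 3 * m + 1) :
    ∃ᶠ X in atTop, LinearFormSolvable 3 ξ w X := by
  obtain ⟨c, hc, hlow⟩ := exists_le_supNorm_pow_mul_abs_aeval (n := 2) hξ (by norm_num; linarith) hS
  set A := 8 * √(6 * (1 + |ξ|) ^ 4) with hA
  have hA₀ : 0 < A := by positivity
  refine frequently_linearFormSolvable_of_rpow (A := 5 * A) (α := (1 - m) / 2)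
    (β := (3 * m + 1) / 2) (by positivity) (by linarith) (by linarith) (by linarith) ?_
  refine tendsto_natCast_atTop_atTop.frequently
    (((frequently_approxError_le four_ne_zero hξ hm₀ h).and_eventually ((eventually_ne_atTop 0).and
      (tendsto_natCast_atTop_atTop.eventually
        (eventually_mul_rpow_neg_lt ((1 + |ξ|) ^ 3) hm₀ hc)))).mono ?_)
  rintro q ⟨herr, hq, hsmall⟩
  have hq₀ : (0 : ℝ) < q := by exact_mod_cast Nat.pos_of_ne_zero hq
  obtain ⟨P, hP, hd, hvan, hH⟩ := exists_polynomial_momentFunctional_eq_zero hξ hq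
    (exists_minor₂_nearest_ne_zero (n := 3) (fun R hR hRd => hlow R hR (hRd.trans one_le_two)) hq
      (lt_of_le_of_lt (by gcongr) hsmall))
  have hheight : P.supNorm ≤ A * (q : ℝ) ^ ((1 - m) / 2) := by
    refine hH.trans ?_
    rw [Real.sqrt_mul (by positivity), ← mul_assoc, ← hA]
    gcongr
    exact sqrt_mul_le_rpow hq₀ herr
  refine ⟨P, hP, hd, hheight.trans (by nlinarith [Real.rpow_nonneg hq₀.le ((1 - m) / 2)]), ?_⟩
  calc |aeval ξ P| ≤ (4 + 1) * (P.supNorm * approxError 4 ξ q) / q := by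
        exact_mod_cast abs_aeval_le_of_momentFunctional_eq_zero hq (hd.trans (Nat.le_succ 3)) hvan
    _ ≤ (4 + 1) * (A * (q : ℝ) ^ ((1 - m) / 2) * q ^ (-m)) / q := by
        have := approxError_nonneg (n := 4) (ξ := ξ) (q := q)
        gcongr
    _ = 5 * A * (q : ℝ) ^ ((1 - m) / 2 + -m - 1) := by
        rw [Real.rpow_sub_one hq₀.ne', Real.rpow_add hq₀]
        ring
    _ = 5 * A * (q : ℝ) ^ (-((3 * m + 1) / 2)) := by
        congr 2
        ring

end OrdinaryExponent

section CrossProduct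

variable {R : Type*} [CommRing R]

/-- The cross product of three vectors in dimension four: the signed maximal minors of the matrix
with rows `c`, `u`, `v`. -/
def crossVec (c u v : Fin 4 → R) : Fin 4 → R :=
  ![-minor₃ c u v 1 2 3, minor₃ c u v 0 2 3, -minor₃ c u v 0 1 3, minor₃ c u v 0 1 2]

theorem minor₃_swap_left {ι : Type*} (c u v : ι → R) (i j k : ι) :
    minor₃ c u v i j k = -minor₃ c u v j i k := by
  simp only [minor₃, minor₂]
  ring

theorem minor₃_swap_right {ι : Type*} (c u v : ι → R) (i j k : ι) :
    minor₃ c u v i j k = -minor₃ c u v i k j := by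
  simp only [minor₃, minor₂]
  ring

theorem minor₃_self_left {ι : Type*} (c u v : ι → R) (i k : ι) : minor₃ c u v i i k = 0 := by
  simp only [minor₃, minor₂]
  ring

theorem minor₃_eq_zero_of_forall_lt {ι : Type*} [LinearOrder ι] {c u v : ι → R}
    (h : ∀ i j k, i < j → j < k → minor₃ c u v i j k = 0) (i j k : ι) :
    minor₃ c u v i j k = 0 := by
  rcases lt_trichotomy i j with hij | hij | hij <;>
    rcases lt_trichotomy j k with hjk | hjk | hjk <;>
    rcases lt_trichotomy i k with hik | hik | hik <;>
    grind [minor₃_swap_left, minor₃_swap_right, minor₃_self_left]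

theorem minor₃_eq_zero_of_crossVec_eq_zero {c u v : Fin 4 → R} (h : crossVec c u v = 0)
    (i j k : Fin 4) : minor₃ c u v i j k = 0 := by
  have h₀ : minor₃ c u v 1 2 3 = 0 := neg_eq_zero.mp (congrFun h 0)
  have h₁ : minor₃ c u v 0 2 3 = 0 := congrFun h 1
  have h₂ : minor₃ c u v 0 1 3 = 0 := neg_eq_zero.mp (congrFun h 2)
  have h₃ : minor₃ c u v 0 1 2 = 0 := congrFun h 3
  refine minor₃_eq_zero_of_forall_lt (fun i j k hij hjk => ?_) i j k
  fin_cases i <;> fin_cases j <;> fin_cases k <;> first | assumption | simp at hij hjk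

theorem crossVec_ne_zero [IsDomain R] {c u v r : Fin 4 → R} (hu : r ⬝ᵥ u = 0) (hv : r ⬝ᵥ v = 0)
    (hc : r ⬝ᵥ c ≠ 0) (h : ∃ i j, minor₂ u v i j ≠ 0) : crossVec c u v ≠ 0 := by
  intro h₀
  obtain ⟨i, j, hij⟩ := h
  refine mul_ne_zero hij hc ((minor₂_mul_dotProduct c hu hv i j).trans ?_)
  simp only [minor₃_eq_zero_of_crossVec_eq_zero h₀, mul_zero, Finset.sum_const_zero]

theorem minor₃_smul_sub {ι : Type*} (t : R) (z e u v : ι → R) (i j k : ι) :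
    minor₃ (t • z - e) u v i j k = t * minor₃ z u v i j k - minor₃ e u v i j k := by
  simp only [minor₃, Pi.sub_apply, Pi.smul_apply, smul_eq_mul]
  ring

theorem crossVec_smul_sub_dotProduct (t : R) (z e u v : Fin 4 → R) :
    crossVec (t • z - e) u v ⬝ᵥ z = crossVec z u v ⬝ᵥ e := by
  simp only [dotProduct, Fin.sum_univ_four, crossVec, minor₃, Matrix.cons_val, Pi.sub_apply,
    Pi.smul_apply, smul_eq_mul]
  ring

theorem crossVec_intCast (c u v : Fin 4 → ℤ) (i : Fin 4) :
    crossVec (fun k => (c k : R)) (fun k => (u k : R)) (fun k => (v k : R)) i =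
      (crossVec c u v i : ℤ) := by
  fin_cases i <;> simp [crossVec, minor₃, minor₂]

theorem abs_crossVec_le {c u v : Fin 4 → ℝ} {B : ℝ} (h : ∀ i j k, |minor₃ c u v i j k| ≤ B)
    (i : Fin 4) : |crossVec c u v i| ≤ B := by
  fin_cases i <;> simp [crossVec, h]

end CrossProduct

section NextApproximation

variable {n : ℕ} {ξ l : ℝ} {k q : ℕ}

theorem exists_next_approximation (hn : n ≠ 0) (hξ : Transcendental ℚ ξ) (hl : 0 < l)
    (hS : ∀ᶠ X in atTop, SimultaneousSolvable n ξ l X) {Y : ℝ} (hY : 1 ≤ Y) :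
    ∃ k q : ℕ, k ≠ 0 ∧ k ≤ Y ∧ Y < q ∧ approxError n ξ q < approxError n ξ k ∧
      ∀ j : ℕ, j ≠ 0 → (j ≤ Y ∨ j < q) → approxError n ξ k ≤ approxError n ξ j := by
  obtain ⟨k, hk, hmin⟩ := Finset.exists_min_image (Finset.Icc 1 ⌊Y⌋₊) (approxError n ξ)
    ⟨1, Finset.mem_Icc.mpr ⟨le_rfl, Nat.le_floor (by simpa using hY)⟩⟩
  have hmin' (j : ℕ) (hj : j ≠ 0) (hjY : j ≤ Y) : approxError n ξ k ≤ approxError n ξ j :=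
    hmin j (Finset.mem_Icc.mpr ⟨Nat.one_le_iff_ne_zero.mpr hj, Nat.le_floor hjY⟩)
  obtain ⟨hk₁, hkY⟩ := Finset.mem_Icc.mp hk
  have hk₀ : k ≠ 0 := Nat.one_le_iff_ne_zero.mp hk₁
  have hex : ∃ q : ℕ, q ≠ 0 ∧ approxError n ξ q < approxError n ξ k := by
    obtain ⟨X, hX, hlt⟩ :=
      (hS.and (eventually_mul_rpow_neg_lt 1 hl (approxError_pos hn hξ hk₀))).exists
    obtain ⟨q, hq, -, herr⟩ := exists_approxError_le_of_simultaneousSolvable hX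
    exact ⟨q, hq, herr.trans_lt (by linarith)⟩
  classical
  obtain ⟨hq₀, hq⟩ := Nat.find_spec hex
  refine ⟨k, Nat.find hex, hk₀, (Nat.le_floor_iff (by linarith)).mp hkY, ?_, hq, ?_⟩
  · by_contra! hle
    exact (hmin' _ hq₀ hle).not_gt hq
  · rintro j hj (hjY | hjq)
    · exact hmin' j hj hjY
    · by_contra! hlt
      exact Nat.find_min hex hjq ⟨hj, hlt⟩

theorem eventually_exists_next_approximation (hn : n ≠ 0) (hξ : Transcendental ℚ ξ) (hl : 0 < l)
    (hS : ∀ᶠ X in atTop, SimultaneousSolvable n ξ l X) :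
    ∀ᶠ Y : ℝ in atTop, ∃ k q : ℕ, k ≠ 0 ∧ k ≤ Y ∧ Y < q ∧ approxError n ξ q < approxError n ξ k ∧
      approxError n ξ k ≤ Y ^ (-l) ∧ approxError n ξ k ≤ (q / 2 : ℝ) ^ (-l) := by
  obtain ⟨T, hT⟩ := eventually_atTop.mp hS
  filter_upwards [eventually_ge_atTop 1, eventually_ge_atTop T, eventually_ge_atTop (2 * T)]
    with Y hY hTY hTY'
  obtain ⟨k, q, hk, hkY, hYq, herr, hmin⟩ := exists_next_approximation hn hξ hl hS hY
  obtain ⟨j, hj, hjY, hjerr⟩ := exists_approxError_le_of_simultaneousSolvable (hT Y hTY)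
  obtain ⟨i, hi, hiq, hierr⟩ :=
    exists_approxError_le_of_simultaneousSolvable (hT (q / 2) (by linarith))
  have hiq' : i < q := by
    have : (i : ℝ) < q := by linarith
    exact_mod_cast this
  exact ⟨k, q, hk, hkY, hYq, herr, (hmin j hj (.inl hjY)).trans hjerr,
    (hmin i hi (.inr hiq')).trans hierr⟩

theorem approxError_le_approxError_of_mul_eq_mul (hk : k ≠ 0) (hkq : k ≤ q)
    (h : ∀ i ≤ n, k * nearest ξ q i = q * nearest ξ k i) :
    approxError n ξ k ≤ approxError n ξ q := by
  have hk' : (0 : ℝ) < k := by exact_mod_cast Nat.pos_of_ne_zero hk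
  refine approxError_le (y := nearest ξ k) fun i hi => ?_
  have hcast : (k : ℝ) * nearest ξ q i = q * nearest ξ k i := by exact_mod_cast h i hi
  refine le_trans (le_of_mul_le_mul_left ?_ hk') (abs_pow_mul_sub_nearest_le hi)
  calc k * |ξ ^ i * k - nearest ξ k i| ≤ q * |ξ ^ i * k - nearest ξ k i| := by gcongr
    _ = |q * (ξ ^ i * k - nearest ξ k i)| := by rw [abs_mul, Nat.abs_cast]
    _ = |k * (ξ ^ i * q - nearest ξ q i)| := by
      congr 1
      linear_combination hcast
    _ = k * |ξ ^ i * q - nearest ξ q i| := by rw [abs_mul, Nat.abs_cast]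

theorem exists_momentFunctional_ne_zero {P Q : ℤ[X]} (hk : k ≠ 0) (hkq : k ≤ q)
    (herr : approxError (2 * n) ξ q < approxError (2 * n) ξ k)
    (hPQ : IsCoprime (P.map (Int.castRingHom ℚ)) (Q.map (Int.castRingHom ℚ)))
    (hP : P.natDegree = n + 1) (hQ : Q.natDegree ≤ n + 1)
    (hkP : ∀ j < n, momentFunctional (nearest ξ k) (X ^ j * P) = 0)
    (hkQ : ∀ j < n, momentFunctional (nearest ξ k) (X ^ j * Q) = 0) :
    ∃ s < n, momentFunctional (nearest ξ q) (X ^ s * P) ≠ 0 ∨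
      momentFunctional (nearest ξ q) (X ^ s * Q) ≠ 0 := by
  by_contra! hzero
  refine herr.not_ge (approxError_le_approxError_of_mul_eq_mul hk hkq fun i hi => ?_)
  have := apply_mul_apply_eq_of_momentFunctional_eq_zero hPQ hP hQ hkP hkQ
    (fun j hj => (hzero j hj).1) (fun j hj => (hzero j hj).2) (Nat.zero_le _) hi
  rwa [nearest_zero, nearest_zero] at this

end NextApproximation

section UniformExponent

variable {m : ℕ} {ξ l : ℝ} {k q s : ℕ}

theorem abs_minor₃_le {ι : Type*} {e u v : ι → ℝ} {a b : ℝ} (he : ∀ i, |e i| ≤ a)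
    (hm : ∀ i j, |minor₂ u v i j| ≤ b) (i j k : ι) : |minor₃ e u v i j k| ≤ 3 * (a * b) := by
  have hterm (i j k : ι) : |e i * minor₂ u v j k| ≤ a * b := by
    rw [abs_mul]
    exact mul_le_mul (he i) (hm j k) (abs_nonneg _) ((abs_nonneg _).trans (he i))
  calc |minor₃ e u v i j k| ≤ |e i * minor₂ u v j k| + |e j * minor₂ u v i k|
        + |e k * minor₂ u v i j| := (abs_add_le _ _).trans (by gcongr; exact abs_sub _ _)
    _ ≤ 3 * (a * b) := by linarith [hterm i j k, hterm j i k, hterm k i j]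

theorem nearest_add_eq_smul_sub (ξ : ℝ) (m q s : ℕ) :
    (fun i : Fin m => (nearest ξ q (i + s) : ℝ)) =
      (ξ ^ s * q) • (fun i : Fin m => ξ ^ (i : ℕ)) -
        fun i : Fin m => ξ ^ ((i : ℕ) + s) * q - nearest ξ q (i + s) := by
  ext i
  simp only [Pi.sub_apply, Pi.smul_apply, smul_eq_mul]
  ring

theorem abs_minor₃_nearest_nearest_le (hk : k ≠ 0) (hkq : k ≤ q) (hs : s ≤ 1)
    (herr : approxError m ξ q ≤ approxError m ξ k) (i j t : Fin m) :
    |minor₃ (fun i : Fin m => (nearest ξ q (i + s) : ℝ)) (fun i => (nearest ξ k i : ℝ))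
      (fun i => (nearest ξ k (i + 1) : ℝ)) i j t| ≤
      24 * ((1 + |ξ|) ^ m) ^ 2 * (q * approxError m ξ k ^ 2) := by
  set B := (1 + |ξ|) ^ m
  set L := approxError m ξ k
  have hB₁ : 1 ≤ B := one_le_pow₀ (by linarith [abs_nonneg ξ])
  have hL : 0 ≤ L := approxError_nonneg
  have hscalar : |ξ ^ s * q| ≤ B * q := by
    rw [abs_mul, Nat.abs_cast]
    gcongr
    exact abs_pow_le_one_add_pow ξ (hs.trans (Nat.one_le_of_lt i.2))
  have herror := abs_minor₃_le (e := fun i : Fin m => ξ ^ ((i : ℕ) + s) * q - nearest ξ q (i + s))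
    (fun i => (abs_pow_mul_sub_nearest_le (by omega)).trans herr)
    (u := fun i => (nearest ξ k i : ℝ)) (v := fun i => (nearest ξ k (i + 1) : ℝ))
    (fun i j => by rw [minor₂_intCast]; exact abs_minor₂_nearest_le hk i j) i j t
  rw [nearest_add_eq_smul_sub, minor₃_smul_sub]
  calc _ ≤ |ξ ^ s * q| * |minor₃ (fun i : Fin m => ξ ^ (i : ℕ)) (fun i => (nearest ξ k i : ℝ))
        (fun i => (nearest ξ k (i + 1) : ℝ)) i j t| + _ :=
        (abs_sub _ _).trans_eq (by rw [abs_mul])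
    _ ≤ B * q * (6 * B * L ^ 2) + 3 * (L * (6 * B * (k * L))) := by
      gcongr
      exact abs_minor₃_nearest_le i j t
    _ ≤ B * q * (6 * B * L ^ 2) + 3 * (L * (6 * (B * B) * (q * L))) := by
      gcongr
      exact le_mul_of_one_le_left (by linarith) hB₁
    _ = 24 * B ^ 2 * (q * L ^ 2) := by ring

theorem abs_crossVec_nearest_dotProduct_le (hs : s ≤ 1) :
    |crossVec (fun i : Fin 4 => (nearest ξ q (i + s) : ℝ)) (fun i => (nearest ξ k i : ℝ))
      (fun i => (nearest ξ k (i + 1) : ℝ)) ⬝ᵥ (fun i => ξ ^ (i : ℕ))| ≤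
      24 * (1 + |ξ|) ^ 4 * (approxError 4 ξ k ^ 2 * approxError 4 ξ q) := by
  rw [nearest_add_eq_smul_sub, crossVec_smul_sub_dotProduct]
  refine (abs_sum_mul_le (abs_crossVec_le abs_minor₃_nearest_le) fun i =>
    abs_pow_mul_sub_nearest_le (n := 4) (by omega)).trans_eq ?_
  rw [Fintype.card_fin]
  push_cast
  ring

theorem exists_polynomial_of_momentFunctional_ne_zero {R : ℤ[X]} (hk : k ≠ 0) (hkq : k ≤ q)
    (hs : s ≤ 1) (herr : approxError 4 ξ q ≤ approxError 4 ξ k) (hR : R.natDegree ≤ 3)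
    (hRk : ∀ j < 2, momentFunctional (nearest ξ k) (X ^ j * R) = 0)
    (hRq : momentFunctional (nearest ξ q) (X ^ s * R) ≠ 0)
    (hminor : ∃ i j : Fin 4,
      minor₂ (fun i : Fin 4 => nearest ξ k i) (fun i => nearest ξ k (i + 1)) i j ≠ 0) :
    ∃ D : ℤ[X], D ≠ 0 ∧ D.natDegree ≤ 3 ∧
      D.supNorm ≤ 24 * ((1 + |ξ|) ^ 4) ^ 2 * (q * approxError 4 ξ k ^ 2) ∧
      |aeval ξ D| ≤ 24 * (1 + |ξ|) ^ 4 * approxError 4 ξ k ^ 3 := by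
  have hdot (x : ℕ → ℤ) (j : ℕ) := coeff_dotProduct_eq_momentFunctional (Nat.lt_succ_of_le hR) x j
  have hcross := crossVec_ne_zero ((hdot _ 0).trans (hRk 0 two_pos))
    ((hdot _ 1).trans (hRk 1 one_lt_two)) (by rwa [hdot]) hminor
  refine ⟨ofFn 4 (crossVec _ _ _), ofFn_ne_zero hcross,
    Nat.le_of_lt_succ (ofFn_natDegree_lt (by norm_num) _), ?_, ?_⟩
  · refine supNorm_ofFn_le (by positivity) fun i => ?_
    rw [← crossVec_intCast]
    exact abs_crossVec_le (abs_minor₃_nearest_nearest_le hk hkq hs herr) i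
  · rw [aeval_ofFn]
    simp only [← crossVec_intCast]
    refine (abs_crossVec_nearest_dotProduct_le hs).trans ?_
    rw [pow_succ (approxError 4 ξ k) 2]
    gcongr

theorem CubicPair.exists_polynomial_of_next_approximation {K N Y : ℝ} {P Q : ℤ[X]}
    (h : CubicPair ξ l K N Y P Q) (hk : k ≠ 0) (hkY : k ≤ Y) (hYq : Y < q)
    (herr : approxError 4 ξ q < approxError 4 ξ k) (hkl : approxError 4 ξ k ≤ Y ^ (-l)) :
    ∃ D : ℤ[X], D ≠ 0 ∧ D.natDegree ≤ 3 ∧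
      D.supNorm ≤ 24 * ((1 + |ξ|) ^ 4) ^ 2 * (q * approxError 4 ξ k ^ 2) ∧
      |aeval ξ D| ≤ 24 * (1 + |ξ|) ^ 4 * approxError 4 ξ k ^ 3 := by
  have hzero := h.momentFunctional_eq_zero k hkY hkl
  have hkq : k ≤ q := by exact_mod_cast (hkY.trans_lt hYq).le
  have hminor := exists_minor₂_ne_zero (m := 4) (x := nearest ξ k)
    (by rwa [nearest_zero, Nat.cast_ne_zero]) h.isCoprime
    (h.left_natDegree_le.trans (Nat.le_succ 3)) (h.right_natDegree_le.trans (Nat.le_succ 3))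
    (by simpa using (hzero 0 two_pos).1) (by simpa using (hzero 0 two_pos).2)
  obtain ⟨s, hs, hP | hQ⟩ := exists_momentFunctional_ne_zero (n := 2) hk hkq herr h.isCoprime
    h.left_natDegree h.right_natDegree_le (fun j hj => (hzero j hj).1) fun j hj => (hzero j hj).2
  · exact exists_polynomial_of_momentFunctional_ne_zero hk hkq (Nat.le_of_lt_succ hs) herr.le
      h.left_natDegree_le (fun j hj => (hzero j hj).1) hP hminor
  · exact exists_polynomial_of_momentFunctional_ne_zero hk hkq (Nat.le_of_lt_succ hs) herr.le
      h.right_natDegree_le (fun j hj => (hzero j hj).2) hQ hminor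

theorem frequently_linearFormSolvable_of_eventually {w : ℝ} (hξ : Transcendental ℚ ξ)
    (hl : 1 / 3 < l) (hl₂ : l < 1 / 2) (hS : ∀ᶠ X in atTop, SimultaneousSolvable 4 ξ l X)
    (hw : w * (1 - 2 * l) < 3 * l) : ∃ᶠ X in atTop, LinearFormSolvable 3 ξ w X := by
  obtain ⟨K, -, hpair⟩ := exists_eventually_cubicPair hξ hl hS
  set B := (1 + |ξ|) ^ 4
  have hB : 1 ≤ B := one_le_pow₀ (by linarith [abs_nonneg ξ])
  set b := (2 : ℝ) ^ l
  have hb₁ : 1 ≤ b := Real.one_le_rpow one_le_two (by linarith)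
  refine frequently_linearFormSolvable_of_rpow (A := 24 * B ^ 2 * b ^ 3) (α := 1 - 2 * l)
    (β := 3 * l) (by positivity) (by linarith) (by linarith) hw (frequently_atTop.mpr fun T => ?_)
  obtain ⟨T', hT'⟩ := eventually_atTop.mp (eventually_exists_next_approximation four_ne_zero hξ
    (by linarith) hS)
  obtain ⟨N, ⟨Y, P, Q, h⟩, hN₀, hNT, hNT'⟩ := (hpair.and ((eventually_gt_atTop 0).and
    ((eventually_ge_atTop T).and (eventually_ge_atTop T')))).exists
  have hNY := h.le_bound
  obtain ⟨k, q, hk, hkY, hYq, herr, hkl, hql⟩ := hT' Y (hNT'.trans hNY)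
  have hq : (0 : ℝ) < q := by linarith
  obtain ⟨D, hD, hd, hH, hv⟩ := h.exists_polynomial_of_next_approximation hk hkY hYq herr hkl
  have hL : 0 ≤ approxError 4 ξ k := approxError_nonneg
  have hLq : approxError 4 ξ k ≤ b * (q : ℝ) ^ (-l) := by
    rwa [Real.div_rpow hq.le zero_le_two, Real.rpow_neg zero_le_two, div_inv_eq_mul,
      mul_comm] at hql
  refine ⟨q, by linarith, D, hD, hd, hH.trans ?_, hv.trans ?_⟩
  · calc 24 * B ^ 2 * (q * approxError 4 ξ k ^ 2)
        ≤ 24 * B ^ 2 * (q * (b * (q : ℝ) ^ (-l)) ^ 2) := by gcongr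
      _ = 24 * B ^ 2 * b ^ 2 * (q : ℝ) ^ (1 - 2 * l) := by
        rw [mul_pow, ← Real.rpow_mul_natCast hq.le, sub_eq_add_neg, Real.rpow_one_add' hq.le]
        · push_cast; ring_nf
        · linarith
      _ ≤ 24 * B ^ 2 * b ^ 3 * (q : ℝ) ^ (1 - 2 * l) := by gcongr; norm_num
  · calc 24 * B * approxError 4 ξ k ^ 3
        ≤ 24 * B ^ 2 * (b * (q : ℝ) ^ (-l)) ^ 3 := by gcongr; exact le_self_pow₀ hB two_ne_zero
      _ = 24 * B ^ 2 * b ^ 3 * (q : ℝ) ^ (-(3 * l)) := by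
        rw [mul_pow, ← Real.rpow_mul_natCast hq.le]
        push_cast
        ring_nf

end UniformExponent

section Suprema

variable {S : Set ℝ} {a c : ℝ}

theorem sSup_image_coe_le (h : ∀ w ∈ S, w ≤ c) :
    sSup ((fun l : ℝ => (l : EReal)) '' S) ≤ (c : EReal) := by
  refine sSup_le ?_
  rintro _ ⟨w, hw, rfl⟩
  exact EReal.coe_le_coe_iff.mpr (h w hw)

theorem coe_le_sSup_image_coe (h : ∀ w < c, w ∈ S) :
    (c : EReal) ≤ sSup ((fun l : ℝ => (l : EReal)) '' S) :=
  EReal.ge_of_forall_gt_iff_ge.mp fun z hz => le_sSup ⟨z, h z (EReal.coe_lt_coe_iff.mp hz), rfl⟩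

theorem isLUB_of_sSup_image_coe_eq (h : sSup ((fun l : ℝ => (l : EReal)) '' S) = a) :
    IsLUB S a := by
  refine ⟨fun l hl => EReal.coe_le_coe_iff.mp ?_, fun u hu => EReal.coe_le_coe_iff.mp ?_⟩
  · exact (le_sSup (Set.mem_image_of_mem _ hl)).trans_eq h
  · exact h.symm.trans_le (sSup_image_coe_le hu)

theorem frequently_mem_of_sSup_image_coe_eq (h : sSup ((fun l : ℝ => (l : EReal)) '' S) = a) :
    ∃ᶠ l in nhds a, l ≤ a ∧ l ∈ S :=
  have ha := isLUB_of_sSup_image_coe_eq h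
  (ha.frequently_nhds_mem ha.nonempty).mono fun _ hl => ⟨ha.1 hl, hl⟩

end Suprema

section ExponentInequalities

variable {ξ a b : ℝ}

theorem ordinary_exponent_le {l m : ℝ} (hξ : Transcendental ℚ ξ) (hl : 1 / 3 < l)
    (hS : ∀ᶠ X in atTop, SimultaneousSolvable 4 ξ l X)
    (hm : ∃ᶠ X in atTop, SimultaneousSolvable 4 ξ m X) :
    m ≤ (1 / (3 * l - 1) - 1) / (1 / (3 * l - 1) + 3) := by
  set W := 1 / (3 * l - 1) with hW
  have hW₁ : 1 < W := by
    rw [hW, lt_div_iff₀ (by linarith)]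
    linarith [uniform_exponent_le hξ hS]
  by_contra! hlt
  have hW₂ : (W - 1) / (W + 3) < 1 := by
    rw [div_lt_one (by linarith)]
    linarith
  obtain ⟨m', hm', hmin⟩ := exists_between (lt_min hlt hW₂)
  obtain ⟨hm'm, hm'₁⟩ := lt_min_iff.mp hmin
  have hm'₀ : 0 < m' := (div_pos (by linarith) (by linarith)).trans hm'
  have hF : ∃ᶠ X in atTop, SimultaneousSolvable 4 ξ m' X :=
    (hm.and_eventually (eventually_ge_atTop 1)).mono fun _ hX => hX.1.mono hX.2 hm'm.le
  have hle : (3 * m' + 1) / (1 - m') ≤ W := le_of_forall_lt_imp_le_of_dense fun w hw =>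
    cubic_exponent_le hξ hl hS (frequently_linearFormSolvable_of_frequently hξ hl hS hm'₀ hm'₁ hF
      ((lt_div_iff₀ (by linarith)).mp hw))
  rw [div_le_iff₀ (by linarith)] at hle
  rw [div_lt_iff₀ (by linarith)] at hm'
  linarith

theorem uniformLambda_le_ordinaryLambda (n : ℕ) (ξ : ℝ) :
    uniformLambda n ξ ≤ ordinaryLambda n ξ :=
  sSup_le_sSup (Set.image_mono fun _ hl => Eventually.frequently hl)

theorem uniformLambda_four_le (hξ : Transcendental ℚ ξ) : uniformLambda 4 ξ ≤ (2 / 5 : ℝ) :=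
  sSup_image_coe_le fun _ hl => uniform_exponent_le hξ hl

theorem ordinaryLambda_four_lt_one (hξ : Transcendental ℚ ξ)
    (h : ((1 / 3 : ℝ) : EReal) < uniformLambda 4 ξ) : ordinaryLambda 4 ξ < (1 : ℝ) := by
  obtain ⟨_, ⟨l, hl, rfl⟩, hlt⟩ := lt_sSup_iff.mp h
  have hl₃ : 0 < 3 * l - 1 := by linarith [EReal.coe_lt_coe_iff.mp hlt]
  refine (sSup_image_coe_le fun m hm => ordinary_exponent_le hξ (by linarith) hl hm).trans_lt
    (EReal.coe_lt_coe_iff.mpr ?_)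
  have : 0 < 1 / (3 * l - 1) := one_div_pos.mpr hl₃
  rw [div_lt_one (by linarith)]
  linarith

theorem exists_exponents_eq_coe (hξ : Transcendental ℚ ξ)
    (h : ((1 / 3 : ℝ) : EReal) < uniformLambda 4 ξ) :
    ∃ a b : ℝ, uniformLambda 4 ξ = a ∧ ordinaryLambda 4 ξ = b ∧
      1 / 3 < a ∧ a ≤ 2 / 5 ∧ a ≤ b ∧ b < 1 := by
  have ha := uniformLambda_four_le hξ
  have hab := uniformLambda_le_ordinaryLambda 4 ξ
  have hb := ordinaryLambda_four_lt_one hξ h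
  lift uniformLambda 4 ξ to ℝ using ⟨ha.trans_lt (EReal.coe_lt_top _) |>.ne, h.ne_bot⟩ with a
  lift ordinaryLambda 4 ξ to ℝ using ⟨hb.ne_top, (h.trans_le hab).ne_bot⟩ with b
  exact ⟨a, b, rfl, rfl, EReal.coe_lt_coe_iff.mp h, EReal.coe_le_coe_iff.mp ha,
    EReal.coe_le_coe_iff.mp hab, EReal.coe_lt_coe_iff.mp hb⟩

theorem ordinaryW_three_le (hξ : Transcendental ℚ ξ) (ha : uniformLambda 4 ξ = a)
    (ha₃ : 1 / 3 < a) : ordinaryW 3 ξ ≤ (1 / (3 * a - 1) : ℝ) := by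
  refine sSup_image_coe_le fun w hw => ?_
  have hcont : ContinuousAt (fun l : ℝ => 1 / (3 * l - 1)) a :=
    ContinuousAt.div (by fun_prop) (by fun_prop) (by linarith)
  exact ge_of_tendsto_of_frequently hcont (((frequently_mem_of_sSup_image_coe_eq ha).and_eventually
    (lt_mem_nhds ha₃)).mono fun l hl => cubic_exponent_le hξ hl.2 hl.1.2 hw)

theorem ordinaryW_two_le (hξ : Transcendental ℚ ξ) (ha : uniformLambda 4 ξ = a)
    (ha₃ : 1 / 3 < a) : ordinaryW 2 ξ ≤ (1 / a : ℝ) := by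
  refine sSup_image_coe_le fun w hw => ?_
  have hcont : ContinuousAt (fun l : ℝ => 1 / l) a :=
    ContinuousAt.div (by fun_prop) (by fun_prop) (by linarith)
  exact ge_of_tendsto_of_frequently hcont (((frequently_mem_of_sSup_image_coe_eq ha).and_eventually
    (lt_mem_nhds ha₃)).mono fun l hl =>
      linearForm_exponent_le (n := 2) hξ (by norm_num; linarith [hl.2]) hl.1.2 hw)

theorem div_one_sub_two_mul_le_ordinaryW_three (hξ : Transcendental ℚ ξ)
    (ha : uniformLambda 4 ξ = a) (ha₃ : 1 / 3 < a) (ha₂ : a < 1 / 2) :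
    ((3 * a / (1 - 2 * a) : ℝ) : EReal) ≤ ordinaryW 3 ξ := by
  refine coe_le_sSup_image_coe fun w hw => ?_
  rw [lt_div_iff₀ (by linarith)] at hw
  have hev : ∀ᶠ l in nhds a, w * (1 - 2 * l) < 3 * l :=
    ContinuousAt.eventually_lt (by fun_prop) (by fun_prop) hw
  obtain ⟨l, ⟨hla, hl⟩, hl₃, hwl⟩ :=
    ((frequently_mem_of_sSup_image_coe_eq ha).and_eventually ((lt_mem_nhds ha₃).and hev)).exists
  exact frequently_linearFormSolvable_of_eventually hξ hl₃ (hla.trans_lt ha₂) hl hwl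

theorem div_one_sub_le_ordinaryW_three (hξ : Transcendental ℚ ξ) (ha : uniformLambda 4 ξ = a)
    (ha₃ : 1 / 3 < a) (hb : ordinaryLambda 4 ξ = b) (hb₀ : 0 < b) (hb₁ : b < 1) :
    (((3 * b + 1) / (1 - b) : ℝ) : EReal) ≤ ordinaryW 3 ξ := by
  refine coe_le_sSup_image_coe fun w hw => ?_
  rw [lt_div_iff₀ (by linarith)] at hw
  have hev : ∀ᶠ m in nhds b, w * (1 - m) < 3 * m + 1 :=
    ContinuousAt.eventually_lt (by fun_prop) (by fun_prop) hw
  obtain ⟨l, ⟨-, hl⟩, hl₃⟩ :=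
    ((frequently_mem_of_sSup_image_coe_eq ha).and_eventually (lt_mem_nhds ha₃)).exists
  obtain ⟨m, ⟨hmb, hm⟩, hm₀, hwm⟩ :=
    ((frequently_mem_of_sSup_image_coe_eq hb).and_eventually ((lt_mem_nhds hb₀).and hev)).exists
  exact frequently_linearFormSolvable_of_frequently hξ hl₃ hl hm₀ (hmb.trans_lt hb₁) hm hwm

theorem one_div_one_sub_two_mul_le_uniformW_three (hξ : Transcendental ℚ ξ)
    (ha : uniformLambda 4 ξ = a) (ha₃ : 1 / 3 < a) (ha₂ : a < 1 / 2) :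
    ((1 / (1 - 2 * a) : ℝ) : EReal) ≤ uniformW 3 ξ := by
  refine coe_le_sSup_image_coe fun w hw => ?_
  have hev : ∀ᶠ l in nhds a, w < 1 / (1 - 2 * l) :=
    ContinuousAt.eventually_lt (by fun_prop)
      (ContinuousAt.div (by fun_prop) (by fun_prop) (by linarith)) hw
  obtain ⟨l, ⟨hla, hl⟩, hl₃, hwl⟩ :=
    ((frequently_mem_of_sSup_image_coe_eq ha).and_eventually ((lt_mem_nhds ha₃).and hev)).exists
  exact eventually_linearFormSolvable hξ hl₃ (hla.trans_lt ha₂) hl hwl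

end ExponentInequalities

/-- The exponents are elements of `EReal`. Below `a` and `b` are the (finite) values of
`λ̂_4(ξ)` and `λ_4(ξ)`; that all denominators are positive is part of the claim. -/
theorem corollary2p2 (ξ : ℝ) (hξ : Transcendental ℚ ξ)
    (h : ((1 / 3 : ℝ) : EReal) < uniformLambda 4 ξ) :
    ∃ a b : ℝ, uniformLambda 4 ξ = (a : EReal) ∧ ordinaryLambda 4 ξ = (b : EReal) ∧
      a < 1 / 2 ∧ b < 1 ∧
      ordinaryW 3 ξ ≤ (((3 * a + 1) / (3 * a - 1) : ℝ) : EReal) ∧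
      ((max (3 * a / (1 - 2 * a)) ((3 * b + 1) / (1 - b)) : ℝ) : EReal) ≤ ordinaryW 3 ξ ∧
      (((3 * a + 1) / (1 - a) : ℝ) : EReal) ≤ uniformW 3 ξ ∧
      ordinaryW 2 ξ ≤ ((1 / a : ℝ) : EReal) ∧ 1 / a < 3 := by
  obtain ⟨a, b, ha, hb, ha₃, ha₅, hab, hb₁⟩ := exists_exponents_eq_coe hξ h
  have ha₂ : a < 1 / 2 := by linarith
  refine ⟨a, b, ha, hb, ha₂, hb₁, ?_, ?_, ?_, ordinaryW_two_le hξ ha ha₃, ?_⟩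
  · refine (ordinaryW_three_le hξ ha ha₃).trans (EReal.coe_le_coe_iff.mpr ?_)
    exact div_le_div_of_nonneg_right (by linarith) (by linarith)
  · rw [EReal.coe_strictMono.monotone.map_max]
    exact max_le (div_one_sub_two_mul_le_ordinaryW_three hξ ha ha₃ ha₂)
      (div_one_sub_le_ordinaryW_three hξ ha ha₃ hb (by linarith) hb₁)
  · refine le_trans (EReal.coe_le_coe_iff.mpr ?_)
      (one_div_one_sub_two_mul_le_uniformW_three hξ ha ha₃ ha₂)
    rw [div_le_div_iff₀ (by linarith) (by linarith)]
    nlinarith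
  · rw [div_lt_iff₀ (by linarith)]
    linarith
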